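/- Let $(M,\langle\cdot,\cdot\rangle)$ be a smooth Riemannian manifold of dimension $2n+1$, $n\ge 1$, with Levi-Civita connection $\nabla$, equipped with an almost contact metric structure $(\varphi,\zeta)$: $\varphi$ is a smooth $(1,1)$-tensor field and $\zeta$ a smooth unit vector field such that, with $\eta=\langle\zeta,\cdot\rangle$, $$\varphi^2=-I+\eta\otimes\zeta,\qquad \langle\varphi X,\varphi Y\rangle=\langle X,Y\rangle-\eta(X)\eta(Y).$$ Notation and conventions: $F=\langle\cdot,\varphi\,\cdot\rangle$; $R_{X,Y}=\nabla_{[X,Y]}-[\nabla_X,\nabla_Y]$; $\{e_i\}$ is any orthonormal basis of the tangent space and repeated indices are summed; $d^*T=-(\nabla_{e_i}T)(e_i,\cdot)$ for one-forms and $(0,2)$-tensors $T$; the inner product of tensors of the same type is the sum of the products of their components in an orthonormal basis (so $\langle A,B\rangle=\langle Ae_j,Be_j\rangle$ for endomorphisms). The intrinsic torsion is $$\xi_X=-\tfrac12\,\varphi\circ\nabla_X\varphi+\nabla_X\eta\otimes\zeta-\tfrac12\,\eta\otimes\nabla_X\zeta ,$$ and $\xi^\flat_X(Y,Z)=\langle\xi_XY,Z\rangle$.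 The almost contact Ricci tensor, its transpose and the ac-scalar curvature are $$\mathrm{Ric}^{\mathrm{ac}}(X,Y)=\langle R_{e_i,X}\varphi e_i,\varphi Y\rangle,\qquad (\mathrm{Ric}^{\mathrm{ac}})^t(X,Y)=\mathrm{Ric}^{\mathrm{ac}}(Y,X),\qquad s^{\mathrm{ac}}=\mathrm{Ric}^{\mathrm{ac}}(e_i,e_i).$$ Identify skew-symmetric endomorphisms $A$ with two-forms $\langle A\cdot,\cdot\rangle$, let $\eta^\perp$ be the one-forms vanishing on $\zeta$, and let $\mathfrak u(n)^\perp_{|\zeta^\perp}$ be the two-forms $b\in\Lambda^2\eta^\perp$ with $b(\varphi X,\varphi Y)=-b(X-\eta(X)\zeta,Y-\eta(Y)\zeta)$. The structure is of type $\mathcal C_1\oplus\dots\oplus\mathcal C_{10}$ if at every point $$\xi\in(\mathcal C_1\oplus\dots\oplus\mathcal C_4)\oplus(\mathcal C_5\oplus\dots\oplus\mathcal C_{10})=\big(\eta^\perp\otimes\mathfrak u(n)^\perp_{|\zeta^\perp}\big)\oplus\big(\eta^\perp\otimes(\eta^\perp\wedge\eta)\big).$$ If the structure is of type $\mathcal C_1\oplus\dots\oplus\mathcal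 C_{10}$, then for every tangent vector $X$ $$2d^*(\mathrm{Ric}^{\mathrm{ac}})^t(X)+ds^{\mathrm{ac}}(X)=2\langle R_{e_i,X},\xi_{\varphi e_i}\circ\varphi\rangle-4\,\mathrm{Ric}^{\mathrm{ac}}(X,\xi_{e_i}e_i)+4\langle\mathrm{Ric}^{\mathrm{ac}},\xi^\flat_X\rangle-2\,d^*F(\zeta)\,\mathrm{Ric}^{\mathrm{ac}}(\zeta,\varphi X).$$ If moreover $M$ is weakly-ac-Einstein, that is $\mathrm{Ric}^{\mathrm{ac}}=\frac1{2n}s^{\mathrm{ac}}(\langle\cdot,\cdot\rangle-\eta\otimes\eta)$, then for every tangent vector $X$ $$(n-1)\,ds^{\mathrm{ac}}(X)+\big(ds^{\mathrm{ac}}(\zeta)+s^{\mathrm{ac}}d^*\eta\big)\eta(X)=2n\langle R_{e_i,X},\xi_{\varphi e_i}\circ\varphi\rangle-2s^{\mathrm{ac}}\langle\xi_{e_i}e_i,X\rangle .$$ -/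

import Mathlib

open Bundle Manifold VectorField
open scoped ContDiff

noncomputable section

set_option linter.unusedSectionVars false

namespace AlmostContact

variable {E : Type*} [NormedAddCommGroup E] [NormedSpace ℝ E] [FiniteDimensional ℝ E]
  {M : Type*} [TopologicalSpace M] [ChartedSpace E M] [IsManifold 𝓘(ℝ, E) ∞ M]
  [RiemannianBundle (fun x : M => TangentSpace 𝓘(ℝ, E) x)]
  [IsContMDiffRiemannianBundle 𝓘(ℝ, E) ∞ E (fun x : M => TangentSpace 𝓘(ℝ, E) x)]

instance (p : M) : FiniteDimensional ℝ (TangentSpace 𝓘(ℝ, E) p) :=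
  inferInstanceAs (FiniteDimensional ℝ E)

/-- The function `p ↦ ⟨X, Y⟩_p`. -/
def metric (X Y : Π x : M, TangentSpace 𝓘(ℝ, E) x) : M → ℝ := fun x => inner ℝ (X x) (Y x)

/-- Half of the right-hand side of the Koszul formula for `2 ⟨∇_V Y, W⟩`. -/
def koszul (Y V W : Π x : M, TangentSpace 𝓘(ℝ, E) x) (p : M) : ℝ :=
  (1 / 2 : ℝ) *
    (mvfderiv 𝓘(ℝ, E) (metric Y W) p (V p)
      + mvfderiv 𝓘(ℝ, E) (metric V W) p (Y p)
      - mvfderiv 𝓘(ℝ, E) (metric V Y) p (W p)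
      + inner ℝ (mlieBracket 𝓘(ℝ, E) V Y p) (W p)
      - inner ℝ (mlieBracket 𝓘(ℝ, E) V W p) (Y p)
      - inner ℝ (mlieBracket 𝓘(ℝ, E) Y W p) (V p))

theorem mdiff_metric {X Y : Π x : M, TangentSpace 𝓘(ℝ, E) x} {p : M}
    (hX : MDiffAt (T% X) p) (hY : MDiffAt (T% Y) p) : MDiffAt (metric X Y) p :=
  MDifferentiableAt.inner_bundle (IB := 𝓘(ℝ, E)) (F := E) (E := fun x : M => TangentSpace 𝓘(ℝ, E) x) hX hY

theorem koszul_tensorial_left {Y W : Π x : M, TangentSpace 𝓘(ℝ, E) x} {p : M}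
    (hY : MDiffAt (T% Y) p) (hW : MDiffAt (T% W) p) :
    TensorialAt 𝓘(ℝ, E) E (fun V => koszul Y V W p) p where
  smul {f V} hf hV := by
    have h1 : metric (f • V) W = f * metric V W := by
      ext x; simp [metric, inner_smul_left]
    have h2 : metric (f • V) Y = f * metric V Y := by
      ext x; simp [metric, inner_smul_left]
    simp only [koszul, h1, h2, mvfderiv_mul hf (mdiff_metric hV hW),
      mvfderiv_mul hf (mdiff_metric hV hY), mlieBracket_smul_left hf hV]
    simp [metric, inner_add_left, inner_smul_left, inner_smul_right]
    rw [real_inner_comm (Y p) (V p), real_inner_comm (W p) (V p)]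
    ring
  add {V V'} hV hV' := by
    have h1 : metric (V + V') W = metric V W + metric V' W := by
      ext x; simp [metric, inner_add_left]
    have h2 : metric (V + V') Y = metric V Y + metric V' Y := by
      ext x; simp [metric, inner_add_left]
    simp only [koszul, h1, h2, mvfderiv_add (mdiff_metric hV hW) (mdiff_metric hV' hW),
      mvfderiv_add (mdiff_metric hV hY) (mdiff_metric hV' hY), mlieBracket_add_left hV hV']
    simp [inner_add_left, inner_add_right]
    ring

theorem koszul_tensorial_right {Y V : Π x : M, TangentSpace 𝓘(ℝ, E) x} {p : M}
    (hY : MDiffAt (T% Y) p) (hV : MDiffAt (T% V) p) :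
    TensorialAt 𝓘(ℝ, E) E (fun W => koszul Y V W p) p where
  smul {f W} hf hW := by
    have h1 : metric Y (f • W) = f * metric Y W := by
      ext x; simp [metric, inner_smul_right]
    have h2 : metric V (f • W) = f * metric V W := by
      ext x; simp [metric, inner_smul_right]
    simp only [koszul, h1, h2, mvfderiv_mul hf (mdiff_metric hY hW),
      mvfderiv_mul hf (mdiff_metric hV hW), mlieBracket_smul_right hf hW]
    simp [metric, inner_add_left, inner_smul_left, inner_smul_right]
    rw [real_inner_comm (Y p) (W p), real_inner_comm (V p) (W p)]
    ring
  add {W W'} hW hW' := by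
    have h1 : metric Y (W + W') = metric Y W + metric Y W' := by
      ext x; simp [metric, inner_add_right]
    have h2 : metric V (W + W') = metric V W + metric V W' := by
      ext x; simp [metric, inner_add_right]
    simp only [koszul, h1, h2, mvfderiv_add (mdiff_metric hV hW) (mdiff_metric hV hW'),
      mvfderiv_add (mdiff_metric hY hW) (mdiff_metric hY hW'), mlieBracket_add_right hW hW']
    simp [inner_add_left, inner_add_right]
    ring

open Classical in
/-- For a vector field `Y` differentiable at `p`, the bilinear form
`(V, W) ↦ ⟨∇_V Y, W⟩` on `T_p M`, read off from the Koszul formula. -/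
def koszulForm (Y : Π x : M, TangentSpace 𝓘(ℝ, E) x) (p : M) :
    TangentSpace 𝓘(ℝ, E) p →L[ℝ] TangentSpace 𝓘(ℝ, E) p →L[ℝ] ℝ :=
  if hY : MDiffAt (T% Y) p then
    TensorialAt.mkHom₂ (fun V W => koszul Y V W p) p
      (fun _ hW => koszul_tensorial_left hY hW) (fun _ hV => koszul_tensorial_right hY hV)
  else 0


theorem koszulForm_apply {Y V W : Π x : M, TangentSpace 𝓘(ℝ, E) x} {p : M}
    (hY : MDiffAt (T% Y) p) (hV : MDiffAt (T% V) p) (hW : MDiffAt (T% W) p) :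
    koszulForm Y p (V p) (W p) = koszul Y V W p := by
  rw [koszulForm, dif_pos hY]
  exact TensorialAt.mkHom₂_apply _ _ hV hW

/-- The endomorphism `v ↦ ∇_v Y` of `T_p M` metrically equivalent to the Koszul form. -/
def koszulDual (Y : Π x : M, TangentSpace 𝓘(ℝ, E) x) (p : M) :
    TangentSpace 𝓘(ℝ, E) p →L[ℝ] TangentSpace 𝓘(ℝ, E) p :=
  let e := stdOrthonormalBasis ℝ (TangentSpace 𝓘(ℝ, E) p)
  ∑ i, ((koszulForm Y p).flip (e i)).smulRight (e i)

theorem inner_koszulDual (Y : Π x : M, TangentSpace 𝓘(ℝ, E) x) (p : M)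
    (v w : TangentSpace 𝓘(ℝ, E) p) :
    inner ℝ (koszulDual Y p v) w = koszulForm Y p v w := by
  simp only [koszulDual]
  conv_rhs => rw [← (stdOrthonormalBasis ℝ (TangentSpace 𝓘(ℝ, E) p)).sum_repr' w]
  simp [sum_inner, inner_smul_left, mul_comm]

theorem clm_ext_of_inner {p : M} {A B : TangentSpace 𝓘(ℝ, E) p →L[ℝ] TangentSpace 𝓘(ℝ, E) p}
    (h : ∀ V W : Π x : M, TangentSpace 𝓘(ℝ, E) x, MDiffAt (T% V) p → MDiffAt (T% W) p →
      (inner ℝ (A (V p)) (W p) : ℝ) = inner ℝ (B (V p)) (W p)) : A = B := by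
  ext v
  refine ext_inner_right ℝ fun w => ?_
  simpa using h (FiberBundle.extend E v) (FiberBundle.extend E w)
    (FiberBundle.mdifferentiableAt_extend 𝓘(ℝ, E) E v)
    (FiberBundle.mdifferentiableAt_extend 𝓘(ℝ, E) E w)

variable (E M) in
/-- The Levi-Civita connection: `leviCivita E M Y p v` is `∇_v Y` at `p`. -/
def leviCivita : CovariantDerivative 𝓘(ℝ, E) E (fun x : M => TangentSpace 𝓘(ℝ, E) x) where
  toFun := koszulDual
  isCovariantDerivativeOnUniv :=
    { add := by
        intro Y Y' p hY hY' _
        refine clm_ext_of_inner fun V W hV hW => ?_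
        rw [add_apply, inner_add_left]
        simp only [inner_koszulDual]
        rw [koszulForm_apply (mdifferentiableAt_add_section hY hY') hV hW, koszulForm_apply hY hV hW,
          koszulForm_apply hY' hV hW]
        have h1 : metric (Y + Y') W = metric Y W + metric Y' W := by
          ext x; simp [metric, inner_add_left]
        have h2 : metric V (Y + Y') = metric V Y + metric V Y' := by
          ext x; simp [metric, inner_add_right]
        simp only [koszul, h1, h2, mvfderiv_add (mdiff_metric hY hW) (mdiff_metric hY' hW),
          mvfderiv_add (mdiff_metric hV hY) (mdiff_metric hV hY'),
          mlieBracket_add_left hY hY', mlieBracket_add_right hY hY']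
        simp [inner_add_left, inner_add_right]
        ring
      leibniz := by
        intro Y f p hY hf _
        refine clm_ext_of_inner fun V W hV hW => ?_
        rw [add_apply, inner_add_left, smul_apply,
          inner_smul_left, ContinuousLinearMap.smulRight_apply, inner_smul_left]
        simp only [inner_koszulDual]
        rw [koszulForm_apply (hf.smul_section hY) hV hW, koszulForm_apply hY hV hW]
        have h1 : metric (f • Y) W = f * metric Y W := by
          ext x; simp [metric, inner_smul_left]
        have h2 : metric V (f • Y) = f * metric V Y := by
          ext x; simp [metric, inner_smul_right]
        simp only [koszul, h1, h2, mvfderiv_mul hf (mdiff_metric hY hW),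
          mvfderiv_mul hf (mdiff_metric hV hY), mlieBracket_smul_left hf hY,
          mlieBracket_smul_right hf hY]
        simp [metric, inner_add_left, inner_smul_left, inner_smul_right]
        rw [real_inner_comm (Y p) (V p)]
        ring }

/-- The Levi-Civita connection is torsion-free. -/
theorem leviCivita_torsion : (leviCivita E M).torsion = 0 := by
  rw [CovariantDerivative.torsion_eq_zero_iff]
  intro X Y p hX hY
  refine ext_inner_right ℝ fun w => ?_
  have hW := FiberBundle.mdifferentiableAt_extend 𝓘(ℝ, E) E w
  have hw : FiberBundle.extend E w p = w := by simp
  rw [inner_sub_left]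
  change inner ℝ (koszulDual Y p (X p)) w - inner ℝ (koszulDual X p (Y p)) w = _
  rw [inner_koszulDual, inner_koszulDual]
  conv_lhs => rw [← hw]
  conv_rhs => rw [← hw]
  rw [koszulForm_apply hY hX hW, koszulForm_apply hX hY hW]
  have hc : metric X Y = metric Y X := by ext x; exact real_inner_comm _ _
  simp only [koszul, hc, mlieBracket_swap_apply (V := Y) (W := X), inner_neg_left]
  ring

/-- The Levi-Civita connection is metric. -/
theorem leviCivita_metric {p : M} {Y Z : Π x : M, TangentSpace 𝓘(ℝ, E) x}
    (hY : MDiffAt (T% Y) p) (hZ : MDiffAt (T% Z) p) (v : TangentSpace 𝓘(ℝ, E) p) :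
    mvfderiv 𝓘(ℝ, E) (fun x => (inner ℝ (Y x) (Z x) : ℝ)) p v =
      inner ℝ (leviCivita E M Y p v) (Z p) + inner ℝ (Y p) (leviCivita E M Z p v) := by
  have hX := FiberBundle.mdifferentiableAt_extend 𝓘(ℝ, E) E v
  have hv : FiberBundle.extend E v p = v := by simp
  change mvfderiv 𝓘(ℝ, E) (metric Y Z) p v =
    inner ℝ (koszulDual Y p v) (Z p) + inner ℝ (Y p) (koszulDual Z p v)
  rw [real_inner_comm (koszulDual Z p v) (Y p), inner_koszulDual, inner_koszulDual, ← hv,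
    koszulForm_apply hY hX hZ, koszulForm_apply hZ hX hY]
  have hc : metric Y Z = metric Z Y := by ext x; exact real_inner_comm _ _
  simp only [koszul, hc, mlieBracket_swap_apply (V := Z) (W := Y), inner_neg_left]
  ring

/-! Tensor calculus. Tangent vectors at `p` are extended to vector fields that are smooth near `p`;
the expressions below are tensorial, so their values do not depend on the extension. -/

/-- The Riemannian curvature tensor, with the convention
`R_{X,Y} = ∇_{[X,Y]} - [∇_X, ∇_Y]`: `curvature p u v w` is `R_{u,v} w`. -/
def curvature (p : M) (u v w : TangentSpace 𝓘(ℝ, E) p) : TangentSpace 𝓘(ℝ, E) p :=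
  let D := leviCivita E M
  let U : Π x : M, TangentSpace 𝓘(ℝ, E) x := FiberBundle.extend E u
  let V : Π x : M, TangentSpace 𝓘(ℝ, E) x := FiberBundle.extend E v
  let W : Π x : M, TangentSpace 𝓘(ℝ, E) x := FiberBundle.extend E w
  D W p (mlieBracket 𝓘(ℝ, E) U V p)
    - (D (fun x => D W x (V x)) p (U p) - D (fun x => D W x (U x)) p (V p))

/-- An orthonormal basis of `T_p M`, used for contractions. -/
abbrev frame (p : M) := stdOrthonormalBasis ℝ (TangentSpace 𝓘(ℝ, E) p)

/-- `(∇_v θ)(w)` for a one-form `θ`. -/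
def nablaForm (θ : Π x : M, TangentSpace 𝓘(ℝ, E) x → ℝ) (p : M)
    (v w : TangentSpace 𝓘(ℝ, E) p) : ℝ :=
  let W : Π x : M, TangentSpace 𝓘(ℝ, E) x := FiberBundle.extend E w
  mvfderiv 𝓘(ℝ, E) (fun x => θ x (W x)) p v - θ p (leviCivita E M W p v)

/-- `(∇_v T)(u, w)` for a `(0,2)`-tensor field `T`. -/
def nablaBilin (T : Π x : M, TangentSpace 𝓘(ℝ, E) x → TangentSpace 𝓘(ℝ, E) x → ℝ) (p : M)
    (v u w : TangentSpace 𝓘(ℝ, E) p) : ℝ :=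
  let U : Π x : M, TangentSpace 𝓘(ℝ, E) x := FiberBundle.extend E u
  let W : Π x : M, TangentSpace 𝓘(ℝ, E) x := FiberBundle.extend E w
  mvfderiv 𝓘(ℝ, E) (fun x => T x (U x) (W x)) p v
    - T p (leviCivita E M U p v) w - T p u (leviCivita E M W p v)

/-- `(∇_v A) w` for a `(1,1)`-tensor field `A`. -/
def nablaEndo (A : Π x : M, TangentSpace 𝓘(ℝ, E) x →L[ℝ] TangentSpace 𝓘(ℝ, E) x) (p : M)
    (v w : TangentSpace 𝓘(ℝ, E) p) : TangentSpace 𝓘(ℝ, E) p :=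
  let W : Π x : M, TangentSpace 𝓘(ℝ, E) x := FiberBundle.extend E w
  leviCivita E M (fun x => A x (W x)) p v - A p (leviCivita E M W p v)

/-- The coderivative `d^* θ = - (∇_{e_i} θ)(e_i)` of a one-form. -/
def codiffForm (θ : Π x : M, TangentSpace 𝓘(ℝ, E) x → ℝ) (p : M) : ℝ :=
  -∑ i, nablaForm θ p (frame p i) (frame p i)

/-- The coderivative `d^* T = - (∇_{e_i} T)(e_i, ·)` of a `(0,2)`-tensor field. -/
def codiffBilin (T : Π x : M, TangentSpace 𝓘(ℝ, E) x → TangentSpace 𝓘(ℝ, E) x → ℝ) (p : M)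
    (w : TangentSpace 𝓘(ℝ, E) p) : ℝ :=
  -∑ i, nablaBilin T p (frame p i) (frame p i) w

variable (E M) in
/-- An almost contact metric structure `(φ, ζ)` on a Riemannian manifold `M`. -/
structure AlmostContactMetric where
  /-- the `(1,1)`-tensor field `φ` -/
  phi : Π x : M, TangentSpace 𝓘(ℝ, E) x →L[ℝ] TangentSpace 𝓘(ℝ, E) x
  /-- the characteristic vector field `ζ` -/
  zeta : Π x : M, TangentSpace 𝓘(ℝ, E) x
  smooth_phi : ContMDiff 𝓘(ℝ, E) (𝓘(ℝ, E).prod 𝓘(ℝ, E →L[ℝ] E)) ∞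
    (fun x => TotalSpace.mk' (E →L[ℝ] E)
      (E := fun x : M => TangentSpace 𝓘(ℝ, E) x →L[ℝ] TangentSpace 𝓘(ℝ, E) x) x (phi x))
  smooth_zeta : ContMDiff 𝓘(ℝ, E) (𝓘(ℝ, E).prod 𝓘(ℝ, E)) ∞
    (fun x => TotalSpace.mk' E (E := fun x : M => TangentSpace 𝓘(ℝ, E) x) x (zeta x))
  zeta_unit : ∀ x, (inner ℝ (zeta x) (zeta x) : ℝ) = 1
  phi_sq : ∀ x (v : TangentSpace 𝓘(ℝ, E) x),
    phi x (phi x v) = -v + (inner ℝ (zeta x) v : ℝ) • zeta x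
  compatible : ∀ x (v w : TangentSpace 𝓘(ℝ, E) x),
    (inner ℝ (phi x v) (phi x w) : ℝ) =
      inner ℝ v w - inner ℝ (zeta x) v * inner ℝ (zeta x) w

namespace AlmostContactMetric

variable (S : AlmostContactMetric E M)

/-- The one-form `η = ζ^♭`. -/
def eta (p : M) (v : TangentSpace 𝓘(ℝ, E) p) : ℝ := inner ℝ (S.zeta p) v

/-- The fundamental two-form `F = ⟨·, φ ·⟩`. -/
def fund (p : M) (v w : TangentSpace 𝓘(ℝ, E) p) : ℝ := inner ℝ v (S.phi p w)

/-- The projection `v ↦ v - η(v) ζ` onto the orthogonal complement of `ζ`. -/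
def hor (p : M) (v : TangentSpace 𝓘(ℝ, E) p) : TangentSpace 𝓘(ℝ, E) p := v - S.eta p v • S.zeta p

/-- The intrinsic torsion `ξ_v w` of the `U(n) × 1`-structure,
`ξ_v = - ½ φ ∘ ∇_v φ + ∇_v η ⊗ ζ - ½ η ⊗ ∇_v ζ`. -/
def xi (p : M) (v w : TangentSpace 𝓘(ℝ, E) p) : TangentSpace 𝓘(ℝ, E) p :=
  -(1 / 2 : ℝ) • S.phi p (nablaEndo S.phi p v w)
    + nablaForm S.eta p v w • S.zeta p
    - ((1 / 2 : ℝ) * S.eta p w) • leviCivita E M S.zeta p v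

/-- The part of `u(n)^⊥` inside `Λ² η^⊥`: skew-symmetric endomorphisms `A` of `T_p M` killing `ζ`
whose two-form `b = ⟨A ·, ·⟩` satisfies `b(φ v, φ w) = - b(v_{ζ^⊥}, w_{ζ^⊥})`. -/
def IsUPerpHor (p : M) (A : TangentSpace 𝓘(ℝ, E) p →ₗ[ℝ] TangentSpace 𝓘(ℝ, E) p) : Prop :=
  (∀ v w, (inner ℝ (A v) w : ℝ) = -inner ℝ v (A w)) ∧ A (S.zeta p) = 0 ∧
    ∀ v w, (inner ℝ (A (S.phi p v)) (S.phi p w) : ℝ) = -inner ℝ (A (S.hor p v)) (S.hor p w)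

/-- The part `η^⊥ ∧ ℝ η` of `u(n)^⊥`: endomorphisms `θ ⊗ ζ - η ⊗ θ^♯` with `θ = ⟨t, ·⟩`, `t ⊥ ζ`. -/
def IsWedgeEta (p : M) (A : TangentSpace 𝓘(ℝ, E) p →ₗ[ℝ] TangentSpace 𝓘(ℝ, E) p) : Prop :=
  ∃ t : TangentSpace 𝓘(ℝ, E) p, S.eta p t = 0 ∧
    ∀ w, A w = (inner ℝ t w : ℝ) • S.zeta p - S.eta p w • t

/-- `C₁ ⊕ C₂ ⊕ C₃ ⊕ C₄ = η^⊥ ⊗ u(n)^⊥|_{ζ^⊥}`. -/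
def IsC1toC4 (p : M)
    (a : TangentSpace 𝓘(ℝ, E) p →ₗ[ℝ] TangentSpace 𝓘(ℝ, E) p →ₗ[ℝ] TangentSpace 𝓘(ℝ, E) p) :
    Prop :=
  a (S.zeta p) = 0 ∧ ∀ v, S.IsUPerpHor p (a v)

/-- `C₅ ⊕ C₆ ⊕ C₇ ⊕ C₈ ⊕ C₉ ⊕ C₁₀ = η^⊥ ⊗ η^⊥ ∧ η`. -/
def IsC5toC10 (p : M)
    (b : TangentSpace 𝓘(ℝ, E) p →ₗ[ℝ] TangentSpace 𝓘(ℝ, E) p →ₗ[ℝ] TangentSpace 𝓘(ℝ, E) p) :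
    Prop :=
  b (S.zeta p) = 0 ∧ ∀ v, S.IsWedgeEta p (b v)

/-- The structure is of type `C₁ ⊕ ... ⊕ C₁₀`. -/
def IsTypeC1toC10 : Prop :=
  ∀ p : M, ∃ a b : TangentSpace 𝓘(ℝ, E) p →ₗ[ℝ] TangentSpace 𝓘(ℝ, E) p →ₗ[ℝ]
      TangentSpace 𝓘(ℝ, E) p,
    S.IsC1toC4 p a ∧ S.IsC5toC10 p b ∧ ∀ v w, S.xi p v w = a v w + b v w

/-- The almost contact Ricci tensor `Ric^ac(v, w) = ⟨R_{e_i, v} φ e_i, φ w⟩`. -/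
def ricAc (p : M) (v w : TangentSpace 𝓘(ℝ, E) p) : ℝ :=
  ∑ i, inner ℝ (curvature p (frame p i) v (S.phi p (frame p i))) (S.phi p w)

/-- The transpose `(Ric^ac)^t(v, w) = Ric^ac(w, v)`. -/
def ricAcT (p : M) (v w : TangentSpace 𝓘(ℝ, E) p) : ℝ := S.ricAc p w v

/-- The ac-scalar curvature `s^ac = Ric^ac(e_i, e_i)`. -/
def scalAc (p : M) : ℝ := ∑ i, S.ricAc p (frame p i) (frame p i)

/-- Weakly-ac-Einstein: `Ric^ac = (1 / 2n) s^ac (⟨·,·⟩ - η ⊗ η)`, where `dim M = 2n + 1`. -/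
def IsWeaklyAcEinstein (n : ℕ) : Prop :=
  ∀ (p : M) (v w : TangentSpace 𝓘(ℝ, E) p),
    S.ricAc p v w = 1 / (2 * n : ℝ) * S.scalAc p * (inner ℝ v w - S.eta p v * S.eta p w)

end AlmostContactMetric

end AlmostContact

end

open Bundle Manifold VectorField
open scoped ContDiff Topology

noncomputable section

set_option linter.unusedSectionVars false

namespace AlmostContact

variable {E : Type*} [NormedAddCommGroup E] [NormedSpace ℝ E] [FiniteDimensional ℝ E]
  {M : Type*} [TopologicalSpace M] [ChartedSpace E M] [IsManifold 𝓘(ℝ, E) ∞ M]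
  [RiemannianBundle (fun x : M => TangentSpace 𝓘(ℝ, E) x)]
  [IsContMDiffRiemannianBundle 𝓘(ℝ, E) ∞ E (fun x : M => TangentSpace 𝓘(ℝ, E) x)]

/-! The first identity is the contracted second Bianchi identity, with every derivative of `φ` kept.
In an orthonormal frame `s^ac` is the contraction of `⟨R_{e_k,e_i} φe_k, φe_i⟩`. Its differential
along `X` therefore contains the contraction of `∇_X R` plus twice a term in `∇_X φ`. Likewise
`d^*(Ric^ac)^t (X)` contains minus the contraction of `(∇_{e_j} R)_{e_k,X}` plus two terms in
`∇_{e_j} φ`. The second Bianchi identity and the skewness of `R` make the `∇R` parts of `2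
d^*(Ric^ac)^t + ds^ac` cancel (`sum_nablaCurv`).

What remains is linear algebra at one point. Since `∇ + ξ` preserves `φ`, `∇_X φ = φ ξ_X - ξ_X φ`
(`B_eq`). Moving skew endomorphisms across contractions and using the symmetries of `R`, the three
remaining terms become the pairing of `Ric^ac` with `ξ_X`, the term in `R` and `ξ_{φe_i} ∘ φ`, and
the term in `ξ_{e_i} e_i` with a correction along `ζ` whose coefficient is `d^*F(ζ)`
(`sum_nabla_phi`, `sum_nabla_phi_contract`, `sum_B_diag`, collected in `contracted_identity`). The
type hypothesis enters only through `∇_ζ ζ = 0`.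

In the weakly-ac-Einstein case `Ric^ac` is symmetric and kills `ζ`, so its pairing with the skew
`ξ_X` and the `d^*F(ζ)` term vanish. Differentiating the Einstein equation computes `d^*(Ric^ac)^t`,
and `η(ξ_{e_i} e_i) = -d^*η` finishes the substitution.

The rest is Riemannian geometry derived from the Koszul formula: smoothness of `∇_V Y`, tensoriality
and symmetries of `R`, and both Bianchi identities. -/

/-- Smoothness of a vector field at a point. -/
def SmoothAt (X : Π x : M, TangentSpace 𝓘(ℝ, E) x) (p : M) : Prop :=
  ContMDiffAt 𝓘(ℝ, E) (𝓘(ℝ, E).prod 𝓘(ℝ, E)) ∞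
    (fun x => TotalSpace.mk' E (E := fun x : M => TangentSpace 𝓘(ℝ, E) x) x (X x)) p

/-- Smoothness of a function at a point. -/
abbrev SmoothFunAt (f : M → ℝ) (p : M) : Prop := ContMDiffAt 𝓘(ℝ, E) 𝓘(ℝ, ℝ) ∞ f p

/-! ### Smooth vector fields near a point and tensoriality. -/

section Calculus

variable {X Y Z U V W : Π x : M, TangentSpace 𝓘(ℝ, E) x} {f g : M → ℝ} {p : M}

theorem SmoothAt.mdiff (h : SmoothAt X p) : MDiffAt (T% X) p :=
  ContMDiffAt.mdifferentiableAt h (by simp)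

/-- Order `∞` at a point only provides, for each finite order, some neighbourhood of regularity.
Order one is what is spread to nearby points here, which suffices for identities between germs. -/
theorem SmoothAt.eventually_mdiff (h : SmoothAt X p) : ∀ᶠ q in 𝓝 p, MDiffAt (T% X) q := by
  have h1 : CMDiffAt 1 (T% X) p := ContMDiffAt.of_le h (by simp)
  filter_upwards [(contMDiffAt_iff_contMDiffAt_nhds (by simp)).1 h1] with q hq
  exact hq.mdifferentiableAt (by simp)

theorem SmoothAt.add (hX : SmoothAt X p) (hY : SmoothAt Y p) : SmoothAt (X + Y) p :=
  ContMDiffAt.add_section hX hY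

theorem SmoothAt.sub (hX : SmoothAt X p) (hY : SmoothAt Y p) : SmoothAt (X - Y) p :=
  ContMDiffAt.sub_section hX hY

theorem SmoothAt.neg (hX : SmoothAt X p) : SmoothAt (-X) p :=
  ContMDiffAt.neg_section hX

theorem SmoothAt.smul (hf : SmoothFunAt (E := E) f p) (hX : SmoothAt X p) : SmoothAt (f • X) p :=
  ContMDiffAt.smul_section hf hX

theorem SmoothAt.sum {ι : Type*} {s : Finset ι} {X : ι → Π x : M, TangentSpace 𝓘(ℝ, E) x}
    (h : ∀ i ∈ s, SmoothAt (X i) p) : SmoothAt (fun x => ∑ i ∈ s, X i x) p :=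
  ContMDiffAt.sum_section h

theorem SmoothAt.congr (hX : SmoothAt X p) (h : Y =ᶠ[𝓝 p] X) : SmoothAt Y p := by
  refine ContMDiffAt.congr_of_eventuallyEq hX ?_
  filter_upwards [h] with q hq
  rw [hq]

theorem SmoothAt.inner (hX : SmoothAt X p) (hY : SmoothAt Y p) :
    SmoothFunAt (E := E) (fun x => (inner ℝ (X x) (Y x) : ℝ)) p :=
  ContMDiffAt.inner_bundle (IB := 𝓘(ℝ, E)) (F := E) (E := fun x : M => TangentSpace 𝓘(ℝ, E) x) hX hY

theorem SmoothAt.bracket (hX : SmoothAt X p) (hY : SmoothAt Y p) :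
    SmoothAt (mlieBracket 𝓘(ℝ, E) X Y) p := by
  have : IsManifold 𝓘(ℝ, E) ((⊤ : ℕ∞) + 1) M :=
    (inferInstance : IsManifold 𝓘(ℝ, E) ∞ M)
  have : IsManifold 𝓘(ℝ, E) (minSmoothness ℝ 2) M := by
    rw [minSmoothness_of_isRCLikeNormedField]
    exact IsManifold.of_le (n := ∞) (WithTop.coe_le_coe.2 (le_top : (2 : ℕ∞) ≤ ⊤))
  exact ContMDiffAt.mlieBracket_vectorField (m := ⊤) (n := ⊤) hX hY (by simp)

theorem SmoothFunAt.deriv (hf : SmoothFunAt (E := E) f p) (hX : SmoothAt X p) :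
    SmoothFunAt (E := E) (fun x => mvfderiv 𝓘(ℝ, E) f x (X x)) p := by
  have h := ContMDiffAt.mfderiv_const (m := ∞) hf (by simp)
  have h2 := ContMDiffAt.clm_apply_of_inCoordinates (F₁ := E) (F₂ := ℝ)
    (E₁ := fun x : M => TangentSpace 𝓘(ℝ, E) x) (E₂ := fun x : ℝ => TangentSpace 𝓘(ℝ, ℝ) x)
    (b₁ := id) (b₂ := f) (v := X) (ϕ := fun x => mfderiv 𝓘(ℝ, E) 𝓘(ℝ, ℝ) f x) h hX hf
  rw [contMDiffAt_totalSpace] at h2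
  refine h2.2.congr_of_eventuallyEq ?_
  filter_upwards with q
  simp [mvfderiv]
  rfl

theorem SmoothFunAt.mdiff (hf : SmoothFunAt (E := E) f p) : MDiffAt f p :=
  ContMDiffAt.mdifferentiableAt hf (by simp)

theorem SmoothFunAt.eventually_mdiff (hf : SmoothFunAt (E := E) f p) :
    ∀ᶠ q in 𝓝 p, MDiffAt f q := by
  have h1 : CMDiffAt 1 f p := ContMDiffAt.of_le hf (by simp)
  filter_upwards [(contMDiffAt_iff_contMDiffAt_nhds (by simp)).1 h1] with q hq
  exact hq.mdifferentiableAt (by simp)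

theorem SmoothFunAt.mul (hf : SmoothFunAt (E := E) f p) (hg : SmoothFunAt (E := E) g p) :
    SmoothFunAt (E := E) (fun x => f x * g x) p := by
  have := ContMDiffAt.smul hf hg
  exact this

theorem SmoothFunAt.comp_contDiffAt {h : ℝ → ℝ} (hf : SmoothFunAt (E := E) f p)
    (hh : ContDiffAt ℝ ∞ h (f p)) : SmoothFunAt (E := E) (fun x => h (f x)) p :=
  ContMDiffAt.comp p (g := h) (hh.contMDiffAt) hf

theorem smoothAt_extend (v : TangentSpace 𝓘(ℝ, E) p) :
    ∀ᶠ q in 𝓝 p, SmoothAt (FiberBundle.extend E v) q := by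
  obtain ⟨s, hs, h⟩ := FiberBundle.exists_contMDiffOn_extend (k := ∞) 𝓘(ℝ, E) E v
  filter_upwards [eventually_eventually_nhds.2 hs] with q hq
  exact h.contMDiffAt hq

/-- An operation on vector fields which is additive and linear over functions, smoothly at `p`,
depends only on the value at `p`. -/
theorem eq_of_smooth_tensorial {A : Type*} [AddCommGroup A] [Module ℝ A]
    {Φ : (Π x : M, TangentSpace 𝓘(ℝ, E) x) → A}
    (hadd : ∀ X Y, SmoothAt X p → SmoothAt Y p → Φ (X + Y) = Φ X + Φ Y)
    (hsmul : ∀ (f : M → ℝ) X, SmoothFunAt (E := E) f p → SmoothAt X p → Φ (f • X) = f p • Φ X)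
    (hX : SmoothAt X p) (hY : SmoothAt Y p) (hXY : X p = Y p) : Φ X = Φ Y := by
  classical
  have hlocal : ∀ {X Y : Π x : M, TangentSpace 𝓘(ℝ, E) x}, SmoothAt X p → SmoothAt Y p →
      X =ᶠ[𝓝 p] Y → Φ X = Φ Y := by
    intro X Y hX hY h
    -- The indicator of the coincidence set equals `1` near `p`, hence is smooth at `p`, and `ψ • X
    -- = ψ • Y` holds everywhere. It plays the role of a bump function.
    let ψ (x : M) : ℝ := if X x = Y x then 1 else 0
    have hψp : ψ p = 1 := by simp [ψ, h.self_of_nhds]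
    have hψ : SmoothFunAt (E := E) ψ p :=
      (contMDiffAt_const (c := (1 : ℝ))).congr_of_eventuallyEq
        (h.mono fun x hx => by simp [ψ, hx])
    have he : ψ • X = ψ • Y := by
      ext1 x
      by_cases hx : X x = Y x <;> simp [ψ, hx]
    calc Φ X = Φ (ψ • X) := by simp [hsmul ψ X hψ hX, hψp]
      _ = Φ (ψ • Y) := by rw [he]
      _ = Φ Y := by simp [hsmul ψ Y hψ hY, hψp]
  let t := trivializationAt E (fun x : M => TangentSpace 𝓘(ℝ, E) x) p
  have ht : p ∈ t.baseSet := FiberBundle.mem_baseSet_trivializationAt E _ p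
  let b := Module.finBasis ℝ E
  let s := t.localFrame b
  let c := t.localFrameCoeff 𝓘(ℝ, E) b
  have hs i : SmoothAt (s i) p := contMDiffAt_localFrame_of_mem ∞ _ b i ht
  have hc {X : Π x : M, TangentSpace 𝓘(ℝ, E) x} (hX : SmoothAt X p) i :
      SmoothFunAt (E := E) (fun x => c i x (X x)) p :=
    _root_.contMDiffAt_localFrameCoeff b ht hX i
  have hsum (J : Finset (Fin (Module.finrank ℝ E))) (k : Fin (Module.finrank ℝ E) → M → ℝ)
      (hk : ∀ i, SmoothFunAt (E := E) (k i) p) :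
      Φ (fun x => ∑ i ∈ J, k i x • s i x) = ∑ i ∈ J, k i p • Φ (s i) := by
    induction J using Finset.induction_on with
    | empty =>
      -- Linearity over the zero function yields `Φ 0 = 0`.
      have := hsmul (fun _ => 0) (X - X) contMDiffAt_const (hX.sub hX)
      simp only [sub_self, smul_zero, zero_smul] at this
      simpa using! this
    | insert a J ha ih =>
      simp only [Finset.sum_insert ha, ← ih]
      rw [← hsmul _ _ (hk a) (hs a)]
      exact hadd _ _ ((hs a).smul (hk a)) (SmoothAt.sum fun i _ => (hs i).smul (hk i))
  have hexp {X : Π x : M, TangentSpace 𝓘(ℝ, E) x} (hX : SmoothAt X p) :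
      Φ X = ∑ i, c i p (X p) • Φ (s i) := by
    have h1 : Φ X = Φ (fun x => ∑ i, c i x (X x) • s i x) :=
      hlocal hX (SmoothAt.sum fun i _ => (hs i).smul (hc hX i))
        (t.eventually_eq_localFrame_sum_coeff_smul b ht)
    rw [h1, hsum Finset.univ (fun i x => c i x (X x)) (hc hX)]
  rw [hexp hX, hexp hY, hXY]

end Calculus

/-- A family of vector fields which is, at `q`, smooth and orthonormal, of full cardinality. -/
structure IsONFrameAt {ι : Type*} (e : ι → Π x : M, TangentSpace 𝓘(ℝ, E) x) (q : M) : Prop where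
  smooth : ∀ i, SmoothAt (e i) q
  orthonormal : Orthonormal ℝ fun i => e i q

/-! ### Smooth local orthonormal frames. -/

section Frame

variable {X Y Z U V W : Π x : M, TangentSpace 𝓘(ℝ, E) x} {f g : M → ℝ} {p : M}

/-- Unnormalised Gram–Schmidt is rational in the inner products, with denominators that do not
vanish at `p`, so smoothness propagates by induction on the index. -/
theorem smoothAt_gramSchmidt {n : ℕ} {X : Fin n → Π x : M, TangentSpace 𝓘(ℝ, E) x}
    (hX : ∀ i, SmoothAt (X i) p)
    (h0 : ∀ i, InnerProductSpace.gramSchmidt ℝ (fun j => X j p) i ≠ 0) (i : Fin n) :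
    SmoothAt (fun x => InnerProductSpace.gramSchmidt ℝ (fun j => X j x) i) p := by
  induction i using WellFoundedLT.induction with
  | ind i ih =>
    have he : (fun x => InnerProductSpace.gramSchmidt ℝ (fun j => X j x) i) =
        X i - fun x => ∑ k ∈ Finset.Iio i,
          ((inner ℝ (InnerProductSpace.gramSchmidt ℝ (fun j => X j x) k) (X i x) : ℝ) *
            (inner ℝ (InnerProductSpace.gramSchmidt ℝ (fun j => X j x) k)
              (InnerProductSpace.gramSchmidt ℝ (fun j => X j x) k) : ℝ)⁻¹) •
            InnerProductSpace.gramSchmidt ℝ (fun j => X j x) k := by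
      ext1 x
      have := InnerProductSpace.gramSchmidt_def'' ℝ (fun j => X j x) i
      simp only [Pi.sub_apply]
      rw [eq_sub_iff_add_eq]
      conv_rhs => rw [this]
      simp [div_eq_mul_inv]
    rw [he]
    refine (hX i).sub (SmoothAt.sum fun k hk => ?_)
    have hk' := ih k (Finset.mem_Iio.1 hk)
    refine SmoothAt.smul (f := fun x =>
      (inner ℝ (InnerProductSpace.gramSchmidt ℝ (fun j => X j x) k) (X i x) : ℝ) *
            (inner ℝ (InnerProductSpace.gramSchmidt ℝ (fun j => X j x) k)
              (InnerProductSpace.gramSchmidt ℝ (fun j => X j x) k) : ℝ)⁻¹) ?_ hk'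
    refine (hk'.inner (hX i)).mul ?_
    refine (hk'.inner hk').comp_contDiffAt (h := fun y => y⁻¹) (contDiffAt_inv ℝ ?_)
    simpa using h0 k

/-- An orthonormal basis of a tangent space extends to a smooth local orthonormal frame. -/
theorem exists_orthonormal_frame {n : ℕ} (e : OrthonormalBasis (Fin n) ℝ (TangentSpace 𝓘(ℝ, E) p)) :
    ∃ F : Fin n → Π x : M, TangentSpace 𝓘(ℝ, E) x,
      (∀ i, F i p = e i) ∧ ∀ᶠ q in 𝓝 p, IsONFrameAt F q := by
  let X : Fin n → Π x : M, TangentSpace 𝓘(ℝ, E) x := fun i => FiberBundle.extend E (e i)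
  let G : Fin n → Π x : M, TangentSpace 𝓘(ℝ, E) x :=
    fun i x => InnerProductSpace.gramSchmidt ℝ (fun j => X j x) i
  have hGp : ∀ i, G i p = e i := by
    intro i
    have : (fun j => X j p) = e := by ext1 j; simp [X]
    simp only [G, this]
    -- At `p` the extended vectors are already orthogonal, so Gram–Schmidt leaves them unchanged and
    -- the frame takes the prescribed values there.
    rw [InnerProductSpace.gramSchmidt_of_orthogonal]
    exact fun i j hij => e.orthonormal.2 hij
  have h0 : ∀ i, InnerProductSpace.gramSchmidt ℝ (fun j => X j p) i ≠ 0 := by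
    intro i
    have := hGp i
    simp only [G] at this
    rw [this]
    exact e.orthonormal.ne_zero i
  have hXs : ∀ᶠ q in 𝓝 p, ∀ i, SmoothAt (X i) q :=
    Filter.eventually_all.2 fun i => smoothAt_extend (e i)
  have hG0 : ∀ᶠ q in 𝓝 p, ∀ i, InnerProductSpace.gramSchmidt ℝ (fun j => X j q) i ≠ 0 := by
    refine Filter.eventually_all.2 fun i => ?_
    have hs := smoothAt_gramSchmidt hXs.self_of_nhds h0 i
    have hc := (hs.inner hs).continuousAt
    have := hc.eventually_ne (y := 0) (by simpa using h0 i)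
    filter_upwards [this] with q hq
    simpa using hq
  refine ⟨fun i x => ((Real.sqrt (inner ℝ (G i x) (G i x)))⁻¹ : ℝ) • G i x, fun i => ?_, ?_⟩
  · simp [hGp]
  · filter_upwards [hXs, hG0] with q hq hq0
    refine ⟨fun i => ?_, ?_⟩
    · have hs := smoothAt_gramSchmidt hq hq0 i
      refine SmoothAt.smul (f := fun x => (Real.sqrt (inner ℝ (G i x) (G i x)))⁻¹) ?_ hs
      have hne : (inner ℝ (G i q) (G i q) : ℝ) ≠ 0 := by simpa using hq0 i
      refine (hs.inner hs).comp_contDiffAt (h := fun y => (Real.sqrt y)⁻¹) ?_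
      refine ContDiffAt.inv (Real.contDiffAt_sqrt hne) ?_
      rw [Real.sqrt_ne_zero']
      exact lt_of_le_of_ne real_inner_self_nonneg hne.symm
    · constructor
      · intro i
        have : ‖G i q‖ ≠ 0 := by simpa using hq0 i
        simp only [real_inner_self_eq_norm_sq, Real.sqrt_sq (norm_nonneg _), norm_smul, norm_inv,
          norm_norm]
        exact inv_mul_cancel₀ this
      · intro i j hij
        simp only [inner_smul_left, inner_smul_right]
        have : (inner ℝ (G i q) (G j q) : ℝ) = 0 :=
          InnerProductSpace.gramSchmidt_orthogonal ℝ _ hij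
        simp [this]

/-- The orthonormal basis of a tangent space given by an orthonormal frame. -/
def IsONFrameAt.basis {ι : Type*} [Fintype ι] {F : ι → Π x : M, TangentSpace 𝓘(ℝ, E) x} {q : M}
    (h : IsONFrameAt F q) (hc : Fintype.card ι = Module.finrank ℝ E) :
    OrthonormalBasis ι ℝ (TangentSpace 𝓘(ℝ, E) q) :=
  OrthonormalBasis.mk h.orthonormal
    (h.orthonormal.linearIndependent.span_eq_top_of_card_eq_finrank' hc).ge

@[simp]
theorem IsONFrameAt.basis_apply {ι : Type*} [Fintype ι]
    {F : ι → Π x : M, TangentSpace 𝓘(ℝ, E) x} {q : M}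
    (h : IsONFrameAt F q) (hc : Fintype.card ι = Module.finrank ℝ E) (i : ι) :
    h.basis hc i = F i q := by simp [IsONFrameAt.basis]

/-- A field is the sum of its components in a smooth orthonormal frame. This is how `∇_V Y`, known
only through the Koszul formula for its inner products, is shown to be smooth. -/
theorem smoothAt_of_inner (h : ∀ Y, SmoothAt Y p →
    SmoothFunAt (E := E) (fun x => (inner ℝ (Y x) (X x) : ℝ)) p) : SmoothAt X p := by
  obtain ⟨F, -, hF⟩ := exists_orthonormal_frame (stdOrthonormalBasis ℝ (TangentSpace 𝓘(ℝ, E) p))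
  have hs : SmoothAt (fun x => ∑ i, (inner ℝ (F i x) (X x) : ℝ) • F i x) p :=
    SmoothAt.sum fun i _ => SmoothAt.smul (h _ (hF.self_of_nhds.smooth i))
      (hF.self_of_nhds.smooth i)
  refine hs.congr ?_
  filter_upwards [hF] with q hq
  have := (hq.basis (by simp; rfl)).sum_repr' (X q)
  simp only [IsONFrameAt.basis_apply] at this
  exact this.symm

end Frame

/-! ### Smoothness of covariant derivatives. -/

section Connection

variable {X Y Z U V W : Π x : M, TangentSpace 𝓘(ℝ, E) x} {f g : M → ℝ} {p : M}

/-- The vector field `∇_V Y`. -/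
def nabla (V Y : Π x : M, TangentSpace 𝓘(ℝ, E) x) : Π x : M, TangentSpace 𝓘(ℝ, E) x :=
  fun x => leviCivita E M Y x (V x)

theorem inner_nabla (hY : MDiffAt (T% Y) p) (hV : MDiffAt (T% V) p) (hW : MDiffAt (T% W) p) :
    (inner ℝ (nabla V Y p) (W p) : ℝ) = koszul Y V W p := by
  rw [← koszulForm_apply hY hV hW, ← inner_koszulDual]
  rfl

theorem smoothFunAt_koszul (hY : SmoothAt Y p) (hV : SmoothAt V p) (hW : SmoothAt W p) :
    SmoothFunAt (E := E) (koszul Y V W) p := by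
  unfold koszul
  have h1 := SmoothFunAt.deriv (hY.inner hW) hV
  have h2 := SmoothFunAt.deriv (hV.inner hW) hY
  have h3 := SmoothFunAt.deriv (hV.inner hY) hW
  have h4 := (hV.bracket hY).inner hW
  have h5 := (hV.bracket hW).inner hY
  have h6 := (hY.bracket hW).inner hV
  exact SmoothFunAt.mul contMDiffAt_const (((((h1.add h2).sub h3).add h4).sub h5).sub h6)

theorem smoothAt_nabla (hV : SmoothAt V p) (hY : SmoothAt Y p) : SmoothAt (nabla V Y) p := by
  refine smoothAt_of_inner fun W hW => ?_
  refine (smoothFunAt_koszul hY hV hW).congr_of_eventuallyEq ?_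
  filter_upwards [hY.eventually_mdiff, hV.eventually_mdiff, hW.eventually_mdiff] with q h1 h2 h3
  rw [real_inner_comm, inner_nabla h1 h2 h3]

end Connection

/-! ### The curvature tensor: tensoriality and algebraic symmetries. -/

section Curvature

variable {X Y Z U V W U' V' W' : Π x : M, TangentSpace 𝓘(ℝ, E) x} {f g : M → ℝ} {p : M}

theorem leviCivita_add (hX : SmoothAt X p) (hY : SmoothAt Y p) (v : TangentSpace 𝓘(ℝ, E) p) :
    leviCivita E M (X + Y) p v = leviCivita E M X p v + leviCivita E M Y p v := by
  rw [(leviCivita E M).isCovariantDerivativeOnUniv.add hX.mdiff hY.mdiff]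
  rfl

theorem leviCivita_smul (hf : MDiffAt f p) (hX : MDiffAt (T% X) p)
    (v : TangentSpace 𝓘(ℝ, E) p) : leviCivita E M (f • X) p v =
      f p • leviCivita E M X p v + mvfderiv 𝓘(ℝ, E) f p v • X p := by
  rw [(leviCivita E M).isCovariantDerivativeOnUniv.leibniz hX hf]
  rfl

theorem leviCivita_neg (hX : SmoothAt X p) (v : TangentSpace 𝓘(ℝ, E) p) :
    leviCivita E M (-X) p v = -leviCivita E M X p v := by
  have h : -X = (-1 : ℝ) • X := by simp
  rw [h, (leviCivita E M).isCovariantDerivativeOnUniv.smul_const (-1) hX.mdiff]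
  simp

theorem leviCivita_sub (hX : SmoothAt X p) (hY : SmoothAt Y p) (v : TangentSpace 𝓘(ℝ, E) p) :
    leviCivita E M (X - Y) p v = leviCivita E M X p v - leviCivita E M Y p v := by
  rw [sub_eq_add_neg, leviCivita_add hX hY.neg, leviCivita_neg hY, ← sub_eq_add_neg]

theorem leviCivita_congr (hX : SmoothAt X p) (h : Y =ᶠ[𝓝 p] X) :
    leviCivita E M Y p = leviCivita E M X p :=
  (leviCivita E M).isCovariantDerivativeOnUniv.congr_of_eventuallyEq (hX.congr h).mdiff hX.mdiff
    Filter.univ_mem h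

theorem nabla_sub_nabla (hU : MDiffAt (T% U) p) (hV : MDiffAt (T% V) p) :
    nabla U V p - nabla V U p = mlieBracket 𝓘(ℝ, E) U V p :=
  (leviCivita E M).torsion_eq_zero_iff.1 leviCivita_torsion hU hV

theorem mvfderiv_congr (h : f =ᶠ[𝓝 p] g) : mvfderiv 𝓘(ℝ, E) f p = mvfderiv 𝓘(ℝ, E) g p := by
  simp only [mvfderiv]
  rw [h.mfderiv_eq, h.self_of_nhds]

theorem mvfderiv_sum {ι : Type*} (s : Finset ι) {f : ι → M → ℝ} (h : ∀ i ∈ s, MDiffAt (f i) p)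
    (v : TangentSpace 𝓘(ℝ, E) p) :
    MDiffAt (fun x => ∑ i ∈ s, f i x) p ∧ mvfderiv 𝓘(ℝ, E) (fun x => ∑ i ∈ s, f i x) p v =
      ∑ i ∈ s, mvfderiv 𝓘(ℝ, E) (f i) p v := by
  classical
  induction s using Finset.induction_on with
  | empty =>
    simp only [Finset.sum_empty]
    exact ⟨mdifferentiableAt_const, by rw [mvfderiv_const]; rfl⟩
  | insert a s ha ih =>
    obtain ⟨h1, h2⟩ := ih fun i hi => h i (Finset.mem_insert_of_mem hi)
    have h3 := h a (Finset.mem_insert_self a s)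
    simp only [Finset.sum_insert ha]
    exact ⟨h3.add h1, by rw [mvfderiv_fun_add h3 h1, ← h2]; rfl⟩

theorem jacobi (hU : SmoothAt U p) (hV : SmoothAt V p) (hW : SmoothAt W p) :
    mlieBracket 𝓘(ℝ, E) U (mlieBracket 𝓘(ℝ, E) V W) p =
      mlieBracket 𝓘(ℝ, E) (mlieBracket 𝓘(ℝ, E) U V) W p
        + mlieBracket 𝓘(ℝ, E) V (mlieBracket 𝓘(ℝ, E) U W) p := by
  have : IsManifold 𝓘(ℝ, E) (minSmoothness ℝ 3) M := by
    rw [minSmoothness_of_isRCLikeNormedField]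
    exact IsManifold.of_le (n := ∞) (WithTop.coe_le_coe.2 (le_top : (3 : ℕ∞) ≤ ⊤))
  have h2 : minSmoothness ℝ 2 ≤ ∞ := by
    rw [minSmoothness_of_isRCLikeNormedField]
    exact WithTop.coe_le_coe.2 (le_top : (2 : ℕ∞) ≤ ⊤)
  exact leibniz_identity_mlieBracket_apply (ContMDiffAt.of_le hU h2) (ContMDiffAt.of_le hV h2)
    (ContMDiffAt.of_le hW h2)

theorem jacobi_cyclic (hU : SmoothAt U p) (hV : SmoothAt V p) (hW : SmoothAt W p) :
    mlieBracket 𝓘(ℝ, E) (mlieBracket 𝓘(ℝ, E) U V) W p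
      + mlieBracket 𝓘(ℝ, E) (mlieBracket 𝓘(ℝ, E) V W) U p
      + mlieBracket 𝓘(ℝ, E) (mlieBracket 𝓘(ℝ, E) W U) V p = 0 := by
  have hj := jacobi hU hV hW
  rw [mlieBracket_swap_apply (V := U), mlieBracket_swap_apply (V := V) (W := mlieBracket _ _ _)] at hj
  have hs : mlieBracket 𝓘(ℝ, E) (mlieBracket 𝓘(ℝ, E) U W) V p
      = -mlieBracket 𝓘(ℝ, E) (mlieBracket 𝓘(ℝ, E) W U) V p := by
    rw [mlieBracket_swap (V := U) (W := W)]
    have := mlieBracket_const_smul_left (I := 𝓘(ℝ, E)) (c := (-1 : ℝ)) (W := V) (hW.bracket hU).mdiff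
    simpa using this
  rw [hs] at hj
  rw [neg_neg] at hj
  rw [add_right_comm, ← hj]
  abel

theorem bracket_smul_eventuallyEq (hf : SmoothFunAt (E := E) f p) (hW : SmoothAt W p) :
    mlieBracket 𝓘(ℝ, E) V (f • W) =ᶠ[𝓝 p]
      (fun x => mvfderiv 𝓘(ℝ, E) f x (V x)) • W + f • mlieBracket 𝓘(ℝ, E) V W := by
  filter_upwards [hf.eventually_mdiff, hW.eventually_mdiff] with q h1 h2
  rw [mlieBracket_smul_right h1 h2]
  rfl

/-- The Lie bracket is the commutator of derivations. -/
theorem mvfderiv_bracket (hf : SmoothFunAt (E := E) f p) (hU : SmoothAt U p) (hV : SmoothAt V p) :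
    mvfderiv 𝓘(ℝ, E) f p (mlieBracket 𝓘(ℝ, E) U V p) =
      mvfderiv 𝓘(ℝ, E) (fun x => mvfderiv 𝓘(ℝ, E) f x (V x)) p (U p)
        - mvfderiv 𝓘(ℝ, E) (fun x => mvfderiv 𝓘(ℝ, E) f x (U x)) p (V p) := by
  -- The argument divides by a field that is nonzero at `p`, so the zero-dimensional case is treated
  -- apart.
  rcases subsingleton_or_nontrivial E with hE | hE
  · have hs : ∀ v : TangentSpace 𝓘(ℝ, E) p, v = 0 := fun v => Subsingleton.elim (α := E) _ _
    rw [hs (mlieBracket 𝓘(ℝ, E) U V p), hs (U p), hs (V p)]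
    simp
  obtain ⟨w, hw⟩ := exists_ne (0 : E)
  let W : Π x : M, TangentSpace 𝓘(ℝ, E) x := FiberBundle.extend E (x := p) w
  have hWp : W p = w :=
    FiberBundle.extend_apply_self (F := E) (E := fun x : M => TangentSpace 𝓘(ℝ, E) x) (x := p) w
  have hW : SmoothAt W p := (smoothAt_extend (p := p) w).self_of_nhds
  have hUf := hf.deriv hU
  have hVf := hf.deriv hV
  -- Expanding the Jacobi identity for `U, V, f • W` and subtracting `f` times the one for `U, V, W`
  -- leaves `([U,V]f - UVf + VUf) • W = 0`.
  have key := jacobi hU hV (hW.smul hf)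
  have e1 : mlieBracket 𝓘(ℝ, E) U (mlieBracket 𝓘(ℝ, E) V (f • W)) p = _ :=
    (Filter.EventuallyEq.refl _ U).mlieBracket_vectorField_eq (bracket_smul_eventuallyEq hf hW)
  have e2 : mlieBracket 𝓘(ℝ, E) V (mlieBracket 𝓘(ℝ, E) U (f • W)) p = _ :=
    (Filter.EventuallyEq.refl _ V).mlieBracket_vectorField_eq (bracket_smul_eventuallyEq hf hW)
  rw [e1, e2, mlieBracket_smul_right hf.mdiff hW.mdiff,
    mlieBracket_add_right (hW.smul hVf).mdiff ((hV.bracket hW).smul hf).mdiff,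
    mlieBracket_add_right (hW.smul hUf).mdiff ((hU.bracket hW).smul hf).mdiff,
    mlieBracket_smul_right hf.mdiff (hV.bracket hW).mdiff,
    mlieBracket_smul_right hf.mdiff (hU.bracket hW).mdiff,
    mlieBracket_smul_right hUf.mdiff hW.mdiff, mlieBracket_smul_right hVf.mdiff hW.mdiff,
    jacobi hU hV hW] at key
  have h0 : (mvfderiv 𝓘(ℝ, E) f p (mlieBracket 𝓘(ℝ, E) U V p) -
      (mvfderiv 𝓘(ℝ, E) (fun x => mvfderiv 𝓘(ℝ, E) f x (V x)) p (U p)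
        - mvfderiv 𝓘(ℝ, E) (fun x => mvfderiv 𝓘(ℝ, E) f x (U x)) p (V p))) • W p = 0 := by
    rw [← sub_eq_zero] at key
    rw [← neg_eq_zero, ← key]
    module
  rcases smul_eq_zero.1 h0 with h | h
  · exact sub_eq_zero.1 h
  · exact absurd (hWp.symm.trans h) hw

/-- The curvature operator on vector fields. -/
def curv (U V W : Π x : M, TangentSpace 𝓘(ℝ, E) x) : Π x : M, TangentSpace 𝓘(ℝ, E) x :=
  nabla (mlieBracket 𝓘(ℝ, E) U V) W - nabla U (nabla V W) + nabla V (nabla U W)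

theorem curv_apply (q : M) : curv U V W q =
    leviCivita E M W q (mlieBracket 𝓘(ℝ, E) U V q) - leviCivita E M (nabla V W) q (U q)
      + leviCivita E M (nabla U W) q (V q) := rfl

theorem smoothAt_curv (hU : SmoothAt U p) (hV : SmoothAt V p) (hW : SmoothAt W p) :
    SmoothAt (curv U V W) p :=
  ((smoothAt_nabla (hU.bracket hV) hW).sub (smoothAt_nabla hU (smoothAt_nabla hV hW))).add
    (smoothAt_nabla hV (smoothAt_nabla hU hW))

theorem curv_swap : curv U V W p = -curv V U W p := by
  simp only [curv_apply]
  rw [mlieBracket_swap_apply, map_neg]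
  abel

theorem nabla_add_right_eventuallyEq (hX : SmoothAt X p) (hY : SmoothAt Y p) :
    nabla V (X + Y) =ᶠ[𝓝 p] nabla V X + nabla V Y := by
  filter_upwards [hX.eventually_mdiff, hY.eventually_mdiff] with q h1 h2
  simp only [nabla, Pi.add_apply]
  rw [(leviCivita E M).isCovariantDerivativeOnUniv.add h1 h2]
  rfl

theorem nabla_add_left : nabla (U + V) W = nabla U W + nabla V W := by
  ext1 q
  simp [nabla]

theorem nabla_smul_left : nabla (f • U) W = f • nabla U W := by
  ext1 q
  simp [nabla]

theorem nabla_smul_right_eventuallyEq (hf : SmoothFunAt (E := E) f p) (hX : SmoothAt X p) :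
    nabla V (f • X) =ᶠ[𝓝 p] f • nabla V X + (fun x => mvfderiv 𝓘(ℝ, E) f x (V x)) • X := by
  filter_upwards [hX.eventually_mdiff, hf.eventually_mdiff] with q h1 h2
  exact leviCivita_smul h2 h1 _

theorem curv_add_left (hU : SmoothAt U p) (hU' : SmoothAt U' p)
    (hW : SmoothAt W p) : curv (U + U') V W p = curv U V W p + curv U' V W p := by
  simp only [curv_apply]
  rw [mlieBracket_add_left hU.mdiff hU'.mdiff, nabla_add_left,
    leviCivita_add (smoothAt_nabla hU hW) (smoothAt_nabla hU' hW)]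
  simp only [map_add, Pi.add_apply]
  abel

theorem curv_smul_left (hf : SmoothFunAt (E := E) f p) (hU : SmoothAt U p)
    (hW : SmoothAt W p) : curv (f • U) V W p = f p • curv U V W p := by
  simp only [curv_apply]
  rw [mlieBracket_smul_left hf.mdiff hU.mdiff, nabla_smul_left,
    leviCivita_smul hf.mdiff (smoothAt_nabla hU hW).mdiff]
  simp only [map_add, map_smul, Pi.smul_apply', nabla]
  module

theorem curv_add_right (hU : SmoothAt U p) (hV : SmoothAt V p)
    (hW : SmoothAt W p) (hW' : SmoothAt W' p) :
    curv U V (W + W') p = curv U V W p + curv U V W' p := by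
  simp only [curv_apply]
  have h1 := smoothAt_nabla hV hW
  have h2 := smoothAt_nabla hV hW'
  have h3 := smoothAt_nabla hU hW
  have h4 := smoothAt_nabla hU hW'
  rw [leviCivita_add hW hW',
    leviCivita_congr (h1.add h2) (nabla_add_right_eventuallyEq hW hW'), leviCivita_add h1 h2,
    leviCivita_congr (h3.add h4) (nabla_add_right_eventuallyEq hW hW'), leviCivita_add h3 h4]
  abel

/-- The first-order Leibniz terms cancel in pairs, and the second derivatives `UVf - VUf` cancel
against `[U,V]f` by `mvfderiv_bracket`. -/
theorem curv_smul_right (hf : SmoothFunAt (E := E) f p) (hU : SmoothAt U p) (hV : SmoothAt V p)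
    (hW : SmoothAt W p) : curv U V (f • W) p = f p • curv U V W p := by
  simp only [curv_apply]
  have h1 := smoothAt_nabla hV hW
  have h3 := smoothAt_nabla hU hW
  have hUf := hf.deriv hU
  have hVf := hf.deriv hV
  rw [leviCivita_smul hf.mdiff hW.mdiff,
    leviCivita_congr ((h1.smul hf).add (hW.smul hVf)) (nabla_smul_right_eventuallyEq hf hW),
    leviCivita_add (h1.smul hf) (hW.smul hVf), leviCivita_smul hf.mdiff h1.mdiff,
    leviCivita_smul hVf.mdiff hW.mdiff,
    leviCivita_congr ((h3.smul hf).add (hW.smul hUf)) (nabla_smul_right_eventuallyEq hf hW),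
    leviCivita_add (h3.smul hf) (hW.smul hUf), leviCivita_smul hf.mdiff h3.mdiff,
    leviCivita_smul hUf.mdiff hW.mdiff, mvfderiv_bracket hf hU hV]
  simp only [nabla]
  module

/-- Tensoriality is applied to one slot at a time, the second slot being reduced to the first by
antisymmetry. It frees `curvature` from the particular extensions in its definition. -/
theorem curv_congr (hU : SmoothAt U p) (hV : SmoothAt V p) (hW : SmoothAt W p)
    (hU' : SmoothAt U' p) (hV' : SmoothAt V' p) (hW' : SmoothAt W' p)
    (h1 : U p = U' p) (h2 : V p = V' p) (h3 : W p = W' p) :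
    curv U V W p = curv U' V' W' p := by
  have e1 : ∀ {A A' B C : Π x : M, TangentSpace 𝓘(ℝ, E) x}, SmoothAt A p → SmoothAt A' p →
      SmoothAt C p → A p = A' p → curv A B C p = curv A' B C p := by
    intro A A' B C hA hA' hC h
    exact eq_of_smooth_tensorial (Φ := fun A => curv A B C p)
      (fun X Y hX hY => curv_add_left hX hY hC)
      (fun f X hf hX => curv_smul_left hf hX hC) hA hA' h
  rw [e1 hU hU' hW h1, curv_swap, e1 hV hV' hW h2, ← curv_swap]
  exact eq_of_smooth_tensorial (Φ := fun A => curv U' V' A p)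
      (fun X Y hX hY => curv_add_right hU' hV' hX hY)
      (fun f X hf hX => curv_smul_right hf hU' hV' hX) hW hW' h3

theorem smoothAt_extend_self (v : TangentSpace 𝓘(ℝ, E) p) :
    SmoothAt (FiberBundle.extend E v) p := (smoothAt_extend v).self_of_nhds

theorem curvature_eq_curv (u v w : TangentSpace 𝓘(ℝ, E) p) : curvature p u v w =
    curv (FiberBundle.extend E u) (FiberBundle.extend E v) (FiberBundle.extend E w) p := by
  simp only [curv_apply, curvature]
  rw [← sub_add]
  rfl

theorem curvature_apply (hU : SmoothAt U p) (hV : SmoothAt V p) (hW : SmoothAt W p) :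
    curvature p (U p) (V p) (W p) = curv U V W p := by
  rw [curvature_eq_curv]
  exact curv_congr (smoothAt_extend_self _) (smoothAt_extend_self _) (smoothAt_extend_self _)
    hU hV hW (by simp) (by simp) (by simp)

theorem curvature_swap (u v w : TangentSpace 𝓘(ℝ, E) p) :
    curvature p u v w = -curvature p v u w := by
  rw [curvature_eq_curv, curvature_eq_curv, curv_swap]

theorem curvature_add_left (u u' v w : TangentSpace 𝓘(ℝ, E) p) :
    curvature p (u + u') v w = curvature p u v w + curvature p u' v w := by
  have hu := smoothAt_extend_self u
  have hu' := smoothAt_extend_self u'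
  have hv := smoothAt_extend_self v
  have hw := smoothAt_extend_self w
  have := curv_add_left (V := FiberBundle.extend E v) hu hu' hw
  rw [← curvature_apply (hu.add hu') hv hw, ← curvature_apply hu hv hw,
    ← curvature_apply hu' hv hw] at this
  simpa using this

theorem curvature_smul_left (c : ℝ) (u v w : TangentSpace 𝓘(ℝ, E) p) :
    curvature p (c • u) v w = c • curvature p u v w := by
  have hu := smoothAt_extend_self u
  have hv := smoothAt_extend_self v
  have hw := smoothAt_extend_self w
  have hc : SmoothFunAt (E := E) (fun _ : M => c) p := contMDiffAt_const
  have := curv_smul_left (V := FiberBundle.extend E v) hc hu hw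
  rw [← curvature_apply (hu.smul hc) hv hw, ← curvature_apply hu hv hw] at this
  simpa using this

theorem curvature_add_right (u v w w' : TangentSpace 𝓘(ℝ, E) p) :
    curvature p u v (w + w') = curvature p u v w + curvature p u v w' := by
  have hu := smoothAt_extend_self u
  have hv := smoothAt_extend_self v
  have hw := smoothAt_extend_self w
  have hw' := smoothAt_extend_self w'
  have := curv_add_right hu hv hw hw'
  rw [← curvature_apply hu hv (hw.add hw'), ← curvature_apply hu hv hw,
    ← curvature_apply hu hv hw'] at this
  simpa using this

theorem curvature_smul_right (c : ℝ) (u v w : TangentSpace 𝓘(ℝ, E) p) :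
    curvature p u v (c • w) = c • curvature p u v w := by
  have hu := smoothAt_extend_self u
  have hv := smoothAt_extend_self v
  have hw := smoothAt_extend_self w
  have hc : SmoothFunAt (E := E) (fun _ : M => c) p := contMDiffAt_const
  have := curv_smul_right hc hu hv hw
  rw [← curvature_apply hu hv (hw.smul hc), ← curvature_apply hu hv hw] at this
  simpa using this

theorem curvature_add_middle (u v v' w : TangentSpace 𝓘(ℝ, E) p) :
    curvature p u (v + v') w = curvature p u v w + curvature p u v' w := by
  rw [curvature_swap, curvature_add_left, curvature_swap v, curvature_swap v']
  abel

theorem curvature_smul_middle (c : ℝ) (u v w : TangentSpace 𝓘(ℝ, E) p) :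
    curvature p u (c • v) w = c • curvature p u v w := by
  rw [curvature_swap, curvature_smul_left, curvature_swap v]
  module

variable (p) in
/-- The curvature tensor `(u, v, w, z) ↦ ⟨R_{u,v} w, z⟩` as a multilinear map. -/
def riem : TangentSpace 𝓘(ℝ, E) p →ₗ[ℝ] TangentSpace 𝓘(ℝ, E) p →ₗ[ℝ]
    TangentSpace 𝓘(ℝ, E) p →ₗ[ℝ] TangentSpace 𝓘(ℝ, E) p →ₗ[ℝ] ℝ :=
  LinearMap.mk₂ ℝ (fun u v => LinearMap.mk₂ ℝ (fun w z => (inner ℝ (curvature p u v w) z : ℝ))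
      (by intros; rw [curvature_add_right, inner_add_left])
      (by intros; rw [curvature_smul_right, inner_smul_left]; rfl)
      (by intros; rw [inner_add_right])
      (by intros; rw [inner_smul_right]; rfl))
    (by intros; ext; simp [curvature_add_left, inner_add_left])
    (by intros; ext; simp [curvature_smul_left, inner_smul_left])
    (by intros; ext; simp [curvature_add_middle, inner_add_left])
    (by intros; ext; simp [curvature_smul_middle, inner_smul_left])

theorem riem_apply (u v w z : TangentSpace 𝓘(ℝ, E) p) :
    riem p u v w z = inner ℝ (curvature p u v w) z := rfl

theorem riem_swap_left (u v w z : TangentSpace 𝓘(ℝ, E) p) :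
    riem p u v w z = -riem p v u w z := by
  simp only [riem_apply]
  rw [curvature_swap, inner_neg_left]

/-- The first Bianchi identity. -/
theorem riem_bianchi (u v w z : TangentSpace 𝓘(ℝ, E) p) :
    riem p u v w z + riem p v w u z + riem p w u v z = 0 := by
  simp only [riem_apply]
  rw [← inner_add_left, ← inner_add_left]
  suffices h : curvature p u v w + curvature p v w u + curvature p w u v = 0 by
    rw [h, inner_zero_left]
  simp only [curvature_eq_curv]
  have hU := smoothAt_extend_self u
  have hV := smoothAt_extend_self v
  have hW := smoothAt_extend_self w
  generalize (FiberBundle.extend E u : Π x : M, TangentSpace 𝓘(ℝ, E) x) = U at *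
  generalize (FiberBundle.extend E v : Π x : M, TangentSpace 𝓘(ℝ, E) x) = V at *
  generalize (FiberBundle.extend E w : Π x : M, TangentSpace 𝓘(ℝ, E) x) = W at *
  -- Zero torsion, used twice, turns `∇_{[A,B]} C` into `[[A,B],C] + ∇_C ∇_A B - ∇_C ∇_B A`. In the
  -- cyclic sum the second derivatives cancel and the Jacobi identity remains.
  have key : ∀ {A B C : Π x : M, TangentSpace 𝓘(ℝ, E) x}, SmoothAt A p → SmoothAt B p →
      SmoothAt C p → leviCivita E M C p (mlieBracket 𝓘(ℝ, E) A B p)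
        = mlieBracket 𝓘(ℝ, E) (mlieBracket 𝓘(ℝ, E) A B) C p
          + leviCivita E M (nabla A B) p (C p) - leviCivita E M (nabla B A) p (C p) := by
    intro A B C hA hB hC
    have h1 := nabla_sub_nabla (hA.bracket hB).mdiff hC.mdiff
    rw [← h1]
    have h2 : mlieBracket 𝓘(ℝ, E) A B =ᶠ[𝓝 p] nabla A B - nabla B A := by
      filter_upwards [hA.eventually_mdiff, hB.eventually_mdiff] with q h1 h2
      exact (nabla_sub_nabla h1 h2).symm
    simp only [nabla]
    rw [leviCivita_congr ((smoothAt_nabla hA hB).sub (smoothAt_nabla hB hA)) h2,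
      leviCivita_sub (smoothAt_nabla hA hB) (smoothAt_nabla hB hA)]
    abel
  simp only [curv_apply]
  rw [key hU hV hW, key hV hW hU, key hW hU hV]
  rw [← jacobi_cyclic hU hV hW]
  abel

theorem mvfderiv_inner (hY : SmoothAt Y p) (hZ : SmoothAt Z p) (v : TangentSpace 𝓘(ℝ, E) p) :
    mvfderiv 𝓘(ℝ, E) (fun x => (inner ℝ (Y x) (Z x) : ℝ)) p v =
      inner ℝ (leviCivita E M Y p v) (Z p) + inner ℝ (Y p) (leviCivita E M Z p v) :=
  leviCivita_metric hY.mdiff hZ.mdiff v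

theorem mvfderiv_inner_eventuallyEq (hY : SmoothAt Y p) (hZ : SmoothAt Z p) :
    (fun x => mvfderiv 𝓘(ℝ, E) (fun x => (inner ℝ (Y x) (Z x) : ℝ)) x (V x)) =ᶠ[𝓝 p]
      fun x => inner ℝ (nabla V Y x) (Z x) + inner ℝ (Y x) (nabla V Z x) := by
  filter_upwards [hY.eventually_mdiff, hZ.eventually_mdiff] with q h1 h2
  exact leviCivita_metric h1 h2 _

/-- Apply `[U,V] = UV - VU` to the function `⟨W,W⟩` and expand with the metric property: the
products `⟨∇_U W, ∇_V W⟩` cancel and twice the curvature term is left. -/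
theorem inner_curv_self (hU : SmoothAt U p) (hV : SmoothAt V p) (hW : SmoothAt W p) :
    (inner ℝ (curv U V W p) (W p) : ℝ) = 0 := by
  have h := mvfderiv_bracket (hW.inner hW) hU hV
  have hVW := smoothAt_nabla hV hW
  have hUW := smoothAt_nabla hU hW
  rw [mvfderiv_congr (mvfderiv_inner_eventuallyEq hW hW),
    mvfderiv_congr (mvfderiv_inner_eventuallyEq (V := U) hW hW), mvfderiv_inner hW hW,
    mvfderiv_fun_add (hVW.inner hW).mdiff (hW.inner hVW).mdiff,
    mvfderiv_fun_add (hUW.inner hW).mdiff (hW.inner hUW).mdiff] at h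
  simp only [add_apply] at h
  rw [mvfderiv_inner hVW hW, mvfderiv_inner hW hVW, mvfderiv_inner hUW hW,
    mvfderiv_inner hW hUW] at h
  rw [curv_apply, inner_add_left, inner_sub_left]
  simp only [real_inner_comm _ (W p)] at h ⊢
  have hc : (inner ℝ (nabla V W p) (leviCivita E M W p (U p)) : ℝ) =
      inner ℝ (leviCivita E M W p (V p)) (nabla U W p) := rfl
  have hc' : (inner ℝ (leviCivita E M W p (U p)) (nabla V W p) : ℝ) =
      inner ℝ (nabla U W p) (leviCivita E M W p (V p)) := rfl
  linarith

theorem riem_self (u v w : TangentSpace 𝓘(ℝ, E) p) : riem p u v w w = 0 := by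
  have h := inner_curv_self (smoothAt_extend_self u) (smoothAt_extend_self v)
    (smoothAt_extend_self w)
  rw [← curvature_eq_curv] at h
  simpa [riem_apply] using h

theorem riem_swap_right (u v w z : TangentSpace 𝓘(ℝ, E) p) :
    riem p u v w z = -riem p u v z w := by
  have h := riem_self u v (w + z)
  simp only [map_add, LinearMap.add_apply, riem_self] at h
  linarith

end Curvature

/-! ### Linear algebra at a point: contractions, curvature tensors and intrinsic torsion. -/

section PointwiseAlgebra

variable {V : Type*} [NormedAddCommGroup V] [InnerProductSpace ℝ V] {ι κ : Type*} [Fintype ι]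
  [Fintype κ]

theorem isBilinearMap_sum {β : V → V → ℝ} (hβ : IsBilinearMap ℝ β) (c d : ι → ℝ) (x y : ι → V)
    (u : V) : β (∑ i, c i • x i) u = ∑ i, c i * β (x i) u ∧
      β u (∑ i, d i • y i) = ∑ i, d i * β u (y i) := by
  have h1 : ∀ u v, β u v = hβ.toLinearMap u v := fun _ _ => rfl
  simp only [h1, map_sum, LinearMap.sum_apply, map_smul, LinearMap.smul_apply, smul_eq_mul,
    and_self]

/-- Transposing an endomorphism across a contraction. -/
theorem sum_adjoint (e : OrthonormalBasis ι ℝ V) {β : V → V → ℝ} (hβ : IsBilinearMap ℝ β)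
    {A A' : V → V} (h : ∀ v w, (inner ℝ (A v) w : ℝ) = inner ℝ v (A' w)) :
    ∑ i, β (A (e i)) (e i) = ∑ i, β (e i) (A' (e i)) := by
  have h1 : ∀ i, β (A (e i)) (e i) = ∑ j, inner ℝ (e j) (A (e i)) * β (e j) (e i) := by
    intro i
    conv_lhs => rw [← e.sum_repr' (A (e i))]
    exact (isBilinearMap_sum hβ _ (fun _ => 0) _ (fun _ => 0) _).1
  have h2 : ∀ j, β (e j) (A' (e j)) = ∑ i, inner ℝ (e i) (A' (e j)) * β (e j) (e i) := by
    intro j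
    conv_lhs => rw [← e.sum_repr' (A' (e j))]
    exact (isBilinearMap_sum hβ (fun _ => 0) _ (fun _ => 0) _ _).2
  simp only [h1, h2]
  rw [Finset.sum_comm]
  refine Finset.sum_congr rfl fun j _ => Finset.sum_congr rfl fun i _ => ?_
  rw [← h, real_inner_comm]

/-- The contraction of a bilinear form does not depend on the orthonormal basis. -/
theorem sum_orthonormalBasis (e : OrthonormalBasis ι ℝ V) (f : OrthonormalBasis κ ℝ V)
    {β : V → V → ℝ} (hβ : IsBilinearMap ℝ β) : ∑ i, β (e i) (e i) = ∑ k, β (f k) (f k) := by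
  have h1 : ∀ i, β (e i) (e i) = ∑ k, inner ℝ (f k) (e i) * β (f k) (e i) := by
    intro i
    conv_lhs => enter [1]; rw [← f.sum_repr' (e i)]
    exact (isBilinearMap_sum hβ _ (fun _ => 0) _ (fun _ => 0) _).1
  have h2 : ∀ k, β (f k) (f k) = ∑ i, inner ℝ (e i) (f k) * β (f k) (e i) := by
    intro k
    conv_lhs => enter [2]; rw [← e.sum_repr' (f k)]
    exact (isBilinearMap_sum hβ (fun _ => 0) _ (fun _ => 0) _ _).2
  simp only [h1, h2]
  rw [Finset.sum_comm]
  simp only [real_inner_comm]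

/-- The symmetries of a Riemannian curvature tensor. -/
structure IsCurvatureTensor (R : V →ₗ[ℝ] V →ₗ[ℝ] V →ₗ[ℝ] V →ₗ[ℝ] ℝ) : Prop where
  swap_left : ∀ u v w z, R u v w z = -R v u w z
  swap_right : ∀ u v w z, R u v w z = -R u v z w
  bianchi : ∀ u v w z, R u v w z + R v w u z + R w u v z = 0

/-- The four first Bianchi identities on `u, v, w, z` combine, modulo antisymmetry in each pair, to
the exchange of pairs. -/
theorem IsCurvatureTensor.pair {R : V →ₗ[ℝ] V →ₗ[ℝ] V →ₗ[ℝ] V →ₗ[ℝ] ℝ}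
    (hR : IsCurvatureTensor R) (u v w z : V) : R u v w z = R w z u v := by
  have h1 := hR.bianchi u v w z
  have h2 := hR.bianchi v w z u
  have h3 := hR.bianchi w z u v
  have h4 := hR.bianchi z u v w
  have a1 := hR.swap_right v w u z
  have a2 := hR.swap_right v w z u
  have a3 := hR.swap_left v w u z
  have b1 := hR.swap_right w z v u
  have c1 := hR.swap_left z v w u
  have c2 := hR.swap_right z v w u
  have c3 := hR.swap_left v z u w
  have d1 := hR.swap_right w u v z
  have d2 := hR.swap_left z u w v
  have d3 := hR.swap_right u z w v
  have d4 := hR.swap_right z u v w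
  have d5 := hR.swap_right u v z w
  have d6 := hR.swap_left u w z v
  linarith

/-- An almost contact metric structure on an inner product space, together with the values at
a point of the covariant derivatives `B = ∇ φ`, `t = ∇ ζ` and of the intrinsic torsion `ξ`. -/
structure IsAlmostContactPoint (φ : V →ₗ[ℝ] V) (ζ : V) (B ξ : V →ₗ[ℝ] V →ₗ[ℝ] V) (t : V →ₗ[ℝ] V) :
    Prop where
  skew : ∀ v w, (inner ℝ (φ v) w : ℝ) = -inner ℝ v (φ w)
  sq : ∀ v, φ (φ v) = -v + (inner ℝ ζ v : ℝ) • ζ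
  map_zeta : φ ζ = 0
  B_skew : ∀ x v w, (inner ℝ (B x v) w : ℝ) = -inner ℝ v (B x w)
  B_anti : ∀ x w, B x (φ w) + φ (B x w) = (inner ℝ (t x) w : ℝ) • ζ + (inner ℝ ζ w : ℝ) • t x
  B_zeta : ∀ x, B x ζ = -φ (t x)
  t_zeta : ∀ x, (inner ℝ ζ (t x) : ℝ) = 0
  xi_eq : ∀ x w, ξ x w = -(1 / 2 : ℝ) • φ (B x w) + (inner ℝ (t x) w : ℝ) • ζ
    - ((1 / 2 : ℝ) * inner ℝ ζ w) • t x

namespace IsAlmostContactPoint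

variable {φ : V →ₗ[ℝ] V} {ζ : V} {B ξ : V →ₗ[ℝ] V →ₗ[ℝ] V} {t : V →ₗ[ℝ] V}
  {R : V →ₗ[ℝ] V →ₗ[ℝ] V →ₗ[ℝ] V →ₗ[ℝ] ℝ}

/-- The failure of `φ ∘ B x` to be skew is measured by `B_anti`, and the terms of `ξ` in `t` are
exactly what compensates it. -/
theorem xi_skew (h : IsAlmostContactPoint φ ζ B ξ t) (x v w : V) :
    (inner ℝ (ξ x v) w : ℝ) = -inner ℝ v (ξ x w) := by
  have h1 := congrArg (fun y => (inner ℝ v y : ℝ)) (h.B_anti x w)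
  simp only [inner_add_right, inner_smul_right] at h1
  have h2 := h.B_skew x v (φ w)
  have h3 := h.skew (B x v) w
  rw [h.xi_eq, h.xi_eq]
  simp only [inner_add_left, inner_sub_left, inner_smul_left, inner_add_right, inner_sub_right,
    inner_smul_right, real_inner_comm ζ v, real_inner_comm (t x) v] at h1 h2 h3 ⊢
  simp only [conj_trivial]
  linarith

theorem inner_zeta_B (h : IsAlmostContactPoint φ ζ B ξ t) (x w : V) :
    (inner ℝ ζ (B x w) : ℝ) = -inner ℝ (t x) (φ w) := by
  have h1 := h.B_skew x ζ w
  rw [h.B_zeta, inner_neg_left, h.skew] at h1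
  linarith

/-- This says that the connection `∇ + ξ` makes `φ` parallel. It converts every `∇φ` in the
divergence computation into `ξ`. -/
theorem B_eq (h : IsAlmostContactPoint φ ζ B ξ t) (x w : V) :
    B x w = φ (ξ x w) - ξ x (φ w) := by
  have h1 := h.B_anti x w
  have h2 : B x (φ w) = (inner ℝ (t x) w : ℝ) • ζ + (inner ℝ ζ w : ℝ) • t x - φ (B x w) :=
    eq_sub_of_add_eq h1
  have h3 : (inner ℝ ζ (φ w) : ℝ) = 0 := by
    have := h.skew ζ w
    rw [h.map_zeta, inner_zero_left] at this
    linarith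
  rw [h.xi_eq, h.xi_eq]
  simp only [h2, map_add, map_sub, map_smul, h.sq, h.map_zeta, h3, h.inner_zeta_B]
  module

theorem xi_phi_adjoint (h : IsAlmostContactPoint φ ζ B ξ t) (x v w : V) :
    (inner ℝ (ξ x (φ v)) w : ℝ) = inner ℝ v (φ (ξ x w)) := by
  rw [h.xi_skew, h.skew, neg_neg]

theorem phi_adjoint (h : IsAlmostContactPoint φ ζ B ξ t) (v w : V) :
    (inner ℝ (φ v) w : ℝ) = inner ℝ v (-φ w) := by
  rw [h.skew, inner_neg_right]

theorem xi_adjoint (h : IsAlmostContactPoint φ ζ B ξ t) (x v w : V) :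
    (inner ℝ (ξ x v) w : ℝ) = inner ℝ v (-ξ x w) := by
  rw [h.xi_skew, inner_neg_right]

/-- Write `B = φξ - ξφ`. By transposition and pair symmetry the `ξφ` half equals minus the `φξ`
half, which gives the factor `2`; transposing `ξ x` then gives the pairing with the almost contact
Ricci form. -/
theorem sum_nabla_phi (h : IsAlmostContactPoint φ ζ B ξ t) (hR : IsCurvatureTensor R)
    (e : OrthonormalBasis ι ℝ V) (x : V) :
    ∑ i, ∑ j, R (e i) (e j) (B x (e i)) (φ (e j)) =
      2 * ∑ i, ∑ k, R (e k) (e i) (φ (e k)) (φ (ξ x (e i))) := by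
  have h1 : ∑ i, ∑ j, R (e i) (e j) (φ (ξ x (e i))) (φ (e j)) =
      ∑ i, ∑ k, R (e k) (e i) (φ (e k)) (φ (ξ x (e i))) := by
    have m1 := sum_adjoint e (β := fun u u' => ∑ j, R u (e j) (φ u') (φ (e j)))
      (by constructor <;> intros <;> simp [Finset.sum_add_distrib, Finset.mul_sum])
      (h.xi_adjoint x)
    have m2 := sum_adjoint e (β := fun u u' => ∑ k, R (e k) u (φ (e k)) (φ u'))
      (by constructor <;> intros <;> simp [Finset.sum_add_distrib, Finset.mul_sum])
      (h.xi_adjoint x)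
    simp only [map_neg, LinearMap.neg_apply, Finset.sum_neg_distrib] at m1 m2
    rw [← neg_inj, ← m1, ← m2]
    refine Finset.sum_congr rfl fun i _ => Finset.sum_congr rfl fun j _ => ?_
    rw [hR.swap_left, hR.swap_right, neg_neg]
  have h2 : ∑ i, ∑ j, R (e i) (e j) (ξ x (φ (e i))) (φ (e j)) =
      -∑ i, ∑ j, R (e i) (e j) (φ (ξ x (e i))) (φ (e j)) := by
    have m1 := sum_adjoint e (β := fun u u' => ∑ j, R u (φ (e j)) u' (e j))
      (by constructor <;> intros <;> simp [Finset.sum_add_distrib, Finset.mul_sum])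
      (h.xi_phi_adjoint x)
    have m2 := fun i => sum_adjoint e (β := fun u u' => R (e i) u (φ (ξ x (e i))) u')
      (by constructor <;> intros <;> simp) h.phi_adjoint
    simp only [map_neg, Finset.sum_neg_distrib] at m1 m2
    simp only [m2, Finset.sum_neg_distrib] at m1
    rw [← m1]
    refine Finset.sum_congr rfl fun i _ => Finset.sum_congr rfl fun j _ => ?_
    rw [hR.pair]
  simp only [h.B_eq, map_sub, LinearMap.sub_apply, Finset.sum_sub_distrib]
  rw [h2, h1]
  ring

/-- For a skew `b` the contraction sees only the part of `R` antisymmetric in the two contracted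
slots, which the first Bianchi identity rewrites. -/
theorem sum_skew (hR : IsCurvatureTensor R) (e : OrthonormalBasis ι ℝ V) {b : V →ₗ[ℝ] V}
    (hb : ∀ v w, (inner ℝ (b v) w : ℝ) = -inner ℝ v (b w)) (x y : V) :
    2 * ∑ i, R (e i) x (b (e i)) y = -∑ i, R y x (e i) (b (e i)) := by
  have m1 := sum_adjoint e (β := fun u u' => R y u u' x)
    (by constructor <;> intros <;> simp) (A := b) (A' := fun w => -b w)
    (fun v w => by rw [hb, inner_neg_right])
  simp only [map_neg, LinearMap.neg_apply, Finset.sum_neg_distrib] at m1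
  have h1 : ∀ i, R (e i) x (b (e i)) y = -R y (b (e i)) (e i) x := fun i => by
    rw [hR.pair, hR.swap_left]
  have h2 : ∀ i, R y x (e i) (b (e i)) = R y (b (e i)) (e i) x - R y (e i) (b (e i)) x := by
    intro i
    rw [hR.pair y x]
    have := hR.bianchi (e i) (b (e i)) y x
    rw [hR.swap_left (b (e i)) y] at this
    linarith
  simp only [h1, h2, Finset.sum_sub_distrib, Finset.sum_neg_distrib] at m1 ⊢
  linarith

/-- `sum_skew` moves both frame vectors of `B (e j)` into one antisymmetric pair, and `φ` is then
transposed onto the direction of differentiation. The two halves of `φξ - ξφ` contribute equally,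
absorbing the factor `2` of `sum_skew`. -/
theorem sum_nabla_phi_contract (h : IsAlmostContactPoint φ ζ B ξ t) (hR : IsCurvatureTensor R)
    (e : OrthonormalBasis ι ℝ V) (x : V) :
    ∑ i, ∑ j, R (e i) x (B (e j) (e i)) (φ (e j)) =
      -∑ i, ∑ j, R (e i) x (e j) (ξ (φ (e i)) (φ (e j))) := by
  have h1 : 2 * ∑ i, ∑ j, R (e i) x (B (e j) (e i)) (φ (e j)) =
      -∑ j, ∑ i, R (φ (e j)) x (e i) (B (e j) (e i)) := by
    rw [Finset.sum_comm, Finset.mul_sum, ← Finset.sum_neg_distrib]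
    exact Finset.sum_congr rfl fun j _ => sum_skew hR e (h.B_skew (e j)) x _
  have m1 := sum_adjoint e (β := fun u u' => ∑ i, R u x (e i) (B u' (e i)))
    (by constructor <;> intros <;> simp [Finset.sum_add_distrib, Finset.mul_sum]) h.phi_adjoint
  simp only [map_neg, LinearMap.neg_apply, Finset.sum_neg_distrib] at m1
  have h2 : ∀ j, ∑ i, R (e j) x (e i) (B (φ (e j)) (e i)) =
      -2 * ∑ i, R (e j) x (e i) (ξ (φ (e j)) (φ (e i))) := by
    intro j
    have m2 := sum_adjoint e (β := fun u u' => R (e j) x u u')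
      (by constructor <;> intros <;> simp) (h.xi_phi_adjoint (φ (e j)))
    simp only [h.B_eq, map_sub, Finset.sum_sub_distrib, ← m2]
    simp only [hR.swap_right (e j) x (ξ _ _), Finset.sum_neg_distrib]
    ring
  simp only [m1, h2, ← Finset.mul_sum] at h1
  linarith

/-- Applying `φ` to the formula for `ξ` recovers `B / 2` up to its `ζ`-component and a term that
sums to a multiple of `φ (t ζ)`. Only here does the first identity need `∇_ζ ζ = 0`. -/
theorem sum_B_diag (h : IsAlmostContactPoint φ ζ B ξ t) (hζ : t ζ = 0)
    (e : OrthonormalBasis ι ℝ V) :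
    ∑ j, B (e j) (e j) =
      (2 : ℝ) • φ (∑ j, ξ (e j) (e j)) + (inner ℝ ζ (∑ j, B (e j) (e j)) : ℝ) • ζ := by
  have h1 : ∑ j, (inner ℝ ζ (e j) : ℝ) • φ (t (e j)) = 0 := by
    have : ∑ j, (inner ℝ ζ (e j) : ℝ) • φ (t (e j)) = φ (t ζ) := by
      conv_rhs => rw [← e.sum_repr' ζ]
      simp [real_inner_comm]
    rw [this, hζ, map_zero]
  have h2 : ∀ j, (2 : ℝ) • φ (ξ (e j) (e j)) =
      B (e j) (e j) - (inner ℝ ζ (B (e j) (e j)) : ℝ) • ζ - (inner ℝ ζ (e j) : ℝ) • φ (t (e j)) := by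
    intro j
    rw [h.xi_eq]
    simp only [map_add, map_sub, map_smul, h.sq, h.map_zeta]
    module
  rw [map_sum, Finset.smul_sum, Finset.sum_congr rfl fun j _ => h2 j]
  simp only [Finset.sum_sub_distrib, h1, inner_sum, Finset.sum_smul]
  abel

/-- Since `φ` is skew and `R` has pair symmetry, the form `∑ R(e_i, y, φe_i, z)` is antisymmetric in
`y, z`. This brings the `ζ`-component to the shape `Ric^ac(ζ, φx)`. -/
theorem sum_riem_zeta (h : IsAlmostContactPoint φ ζ B ξ t) (hR : IsCurvatureTensor R)
    (e : OrthonormalBasis ι ℝ V) (x : V) :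
    ∑ i, R (e i) x (φ (e i)) ζ = ∑ i, R (e i) ζ (φ (e i)) (φ (φ x)) := by
  have key : ∀ y z, ∑ i, R (e i) y (φ (e i)) z = -∑ i, R (e i) z (φ (e i)) y := by
    intro y z
    have m := sum_adjoint e (β := fun u u' => R u y u' z)
      (by constructor <;> intros <;> simp) h.phi_adjoint
    simp only [map_neg, LinearMap.neg_apply, Finset.sum_neg_distrib] at m
    rw [← neg_eq_iff_eq_neg.2 m]
    congr 1
    refine Finset.sum_congr rfl fun i _ => ?_
    rw [hR.pair]
  have h0 := key ζ ζ
  have h0' : ∑ i, R (e i) ζ (φ (e i)) ζ = 0 := by linarith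
  simp only [h.sq, map_add, map_neg, map_smul, Finset.sum_add_distrib, Finset.sum_neg_distrib,
    smul_eq_mul, ← Finset.mul_sum, h0', mul_zero, add_zero]
  exact key x ζ

/-- The pointwise form of the contracted second Bianchi identity. -/
theorem contracted_identity (h : IsAlmostContactPoint φ ζ B ξ t) (hR : IsCurvatureTensor R)
    (hζ : t ζ = 0) (e : OrthonormalBasis ι ℝ V) (x : V) :
    2 * ∑ i, ∑ j, R (e i) (e j) (B x (e i)) (φ (e j))
        - 2 * ∑ i, ∑ j, R (e i) x (B (e j) (e i)) (φ (e j))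
        - 2 * ∑ i, R (e i) x (φ (e i)) (∑ j, B (e j) (e j)) =
      2 * ∑ i, ∑ j, R (e i) x (e j) (ξ (φ (e i)) (φ (e j)))
        - 4 * ∑ i, R (e i) x (φ (e i)) (φ (∑ j, ξ (e j) (e j)))
        + 4 * ∑ i, ∑ k, R (e k) (e i) (φ (e k)) (φ (ξ x (e i)))
        - 2 * inner ℝ ζ (∑ j, B (e j) (e j)) * ∑ i, R (e i) ζ (φ (e i)) (φ (φ x)) := by
  have h1 : ∑ i, R (e i) x (φ (e i)) (∑ j, B (e j) (e j)) =
      2 * ∑ i, R (e i) x (φ (e i)) (φ (∑ j, ξ (e j) (e j)))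
        + inner ℝ ζ (∑ j, B (e j) (e j)) * ∑ i, R (e i) x (φ (e i)) ζ := by
    conv_lhs => rw [h.sum_B_diag hζ e]
    simp only [map_add, map_smul, smul_eq_mul, Finset.sum_add_distrib, ← Finset.mul_sum]
  rw [h1, h.sum_nabla_phi hR, h.sum_nabla_phi_contract hR, h.sum_riem_zeta hR]
  ring

end IsAlmostContactPoint

end PointwiseAlgebra

/-! ### The covariant derivative of curvature and the second Bianchi identity. -/

section SecondBianchi

variable {X Y Z U V W : Π x : M, TangentSpace 𝓘(ℝ, E) x} {f g : M → ℝ} {p : M}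

theorem isCurvatureTensor_riem (p : M) : IsCurvatureTensor (riem (E := E) p) :=
  ⟨riem_swap_left, riem_swap_right, riem_bianchi⟩

/-- The covariant derivative `(∇_v R)_{U,V} W` of the curvature tensor, in terms of vector fields. -/
def nablaCurv (p : M) (v : TangentSpace 𝓘(ℝ, E) p) (U V W : Π x : M, TangentSpace 𝓘(ℝ, E) x) :
    TangentSpace 𝓘(ℝ, E) p :=
  leviCivita E M (curv U V W) p v - curvature p (leviCivita E M U p v) (V p) (W p)
    - curvature p (U p) (leviCivita E M V p v) (W p)
    - curvature p (U p) (V p) (leviCivita E M W p v)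

theorem nablaCurv_swap (hU : SmoothAt U p) (hV : SmoothAt V p) (hW : SmoothAt W p)
    (v : TangentSpace 𝓘(ℝ, E) p) : nablaCurv p v U V W = -nablaCurv p v V U W := by
  have h : curv U V W = -curv V U W := by ext1 q; exact curv_swap
  simp only [nablaCurv]
  rw [h, leviCivita_neg (smoothAt_curv hV hU hW), curvature_swap (leviCivita E M U p v),
    curvature_swap (U p) (leviCivita E M V p v), curvature_swap (U p) (V p)]
  abel

theorem leviCivita_curv (hU : SmoothAt U p) (hV : SmoothAt V p) (hW : SmoothAt W p)
    (v : TangentSpace 𝓘(ℝ, E) p) : leviCivita E M (curv U V W) p v =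
      leviCivita E M (nabla (mlieBracket 𝓘(ℝ, E) U V) W) p v
        - leviCivita E M (nabla U (nabla V W)) p v + leviCivita E M (nabla V (nabla U W)) p v := by
  have h1 := smoothAt_nabla (hU.bracket hV) hW
  have h2 := smoothAt_nabla hU (smoothAt_nabla hV hW)
  have h3 := smoothAt_nabla hV (smoothAt_nabla hU hW)
  rw [curv, leviCivita_add (h1.sub h2) h3, leviCivita_sub h1 h2]

/-- The second Bianchi identity. -/
theorem second_bianchi (hX : SmoothAt X p) (hU : SmoothAt U p) (hV : SmoothAt V p)
    (hW : SmoothAt W p) : nablaCurv p (X p) U V W + nablaCurv p (U p) V X W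
      + nablaCurv p (V p) X U W = 0 := by
  -- By zero torsion, the corrections for differentiating the first two slots of `R` pair up into
  -- `R_{[A,B],C} W`.
  have hb : ∀ {A B C : Π x : M, TangentSpace 𝓘(ℝ, E) x}, SmoothAt A p → SmoothAt B p →
      SmoothAt C p → curvature p (leviCivita E M B p (A p)) (C p) (W p)
        + curvature p (C p) (leviCivita E M A p (B p)) (W p) =
          leviCivita E M W p (mlieBracket 𝓘(ℝ, E) (mlieBracket 𝓘(ℝ, E) A B) C p)
            - leviCivita E M (nabla C W) p (mlieBracket 𝓘(ℝ, E) A B p)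
            + leviCivita E M (nabla (mlieBracket 𝓘(ℝ, E) A B) W) p (C p) := by
    intro A B C hA hB hC
    rw [curvature_swap (C p), ← curv_apply, ← curvature_apply (hA.bracket hB) hC hW,
      ← nabla_sub_nabla hA.mdiff hB.mdiff, sub_eq_add_neg, curvature_add_left,
      ← neg_one_smul ℝ (nabla B A p), curvature_smul_left, neg_one_smul]
    rfl
  have hc : ∀ {A B C : Π x : M, TangentSpace 𝓘(ℝ, E) x}, SmoothAt A p → SmoothAt B p →
      SmoothAt C p → curvature p (A p) (B p) (leviCivita E M W p (C p)) =
        leviCivita E M (nabla C W) p (mlieBracket 𝓘(ℝ, E) A B p)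
          - leviCivita E M (nabla B (nabla C W)) p (A p)
          + leviCivita E M (nabla A (nabla C W)) p (B p) := by
    intro A B C hA hB hC
    rw [← curv_apply, ← curvature_apply hA hB (smoothAt_nabla hC hW)]
    rfl
  have hj : mlieBracket 𝓘(ℝ, E) (mlieBracket 𝓘(ℝ, E) X U) V p
      + mlieBracket 𝓘(ℝ, E) (mlieBracket 𝓘(ℝ, E) U V) X p
      + mlieBracket 𝓘(ℝ, E) (mlieBracket 𝓘(ℝ, E) V X) U p = 0 :=
    jacobi_cyclic hX hU hV
  have hj' := congrArg (leviCivita E M W p) hj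
  simp only [map_add, map_zero] at hj'
  have b1 := hb hX hU hV
  have b2 := hb hU hV hX
  have b3 := hb hV hX hU
  simp only [nablaCurv]
  rw [leviCivita_curv hU hV hW, leviCivita_curv hV hX hW, leviCivita_curv hX hU hW,
    hc hU hV hX, hc hV hX hU, hc hX hU hV]
  -- All third derivatives of `W` cancel; what survives is `∇W` on the cyclic sum of double
  -- brackets, zero by Jacobi. The fields need not commute or be parallel at `p`.
  linear_combination (norm := module) (-1 : ℝ) • b1 - b2 - b3 - hj'

theorem mvfderiv_inner_curv (hU : SmoothAt U p) (hV : SmoothAt V p) (hW : SmoothAt W p)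
    (hZ : SmoothAt Z p) (v : TangentSpace 𝓘(ℝ, E) p) :
    mvfderiv 𝓘(ℝ, E) (fun x => (inner ℝ (curv U V W x) (Z x) : ℝ)) p v =
      inner ℝ (nablaCurv p v U V W) (Z p)
        + riem p (leviCivita E M U p v) (V p) (W p) (Z p)
        + riem p (U p) (leviCivita E M V p v) (W p) (Z p)
        + riem p (U p) (V p) (leviCivita E M W p v) (Z p)
        + riem p (U p) (V p) (W p) (leviCivita E M Z p v) := by
  rw [mvfderiv_inner (smoothAt_curv hU hV hW) hZ, ← curvature_apply hU hV hW]
  simp only [nablaCurv, inner_sub_left, riem_apply]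
  ring

end SecondBianchi

/-! ### Covariant derivatives of endomorphism fields. -/

section EndomorphismFields

variable {X Y Z U V W : Π x : M, TangentSpace 𝓘(ℝ, E) x} {f g : M → ℝ} {p : M}

/-- A field of endomorphisms that maps vector fields smooth at `p` to vector fields smooth at `p`. -/
def SmoothEndoAt (A : Π x : M, TangentSpace 𝓘(ℝ, E) x →L[ℝ] TangentSpace 𝓘(ℝ, E) x) (p : M) : Prop :=
  ∀ X, SmoothAt X p → SmoothAt (fun x => A x (X x)) p

variable {A : Π x : M, TangentSpace 𝓘(ℝ, E) x →L[ℝ] TangentSpace 𝓘(ℝ, E) x}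

theorem nablaEndo_apply (hA : SmoothEndoAt A p) (hX : SmoothAt X p)
    (v : TangentSpace 𝓘(ℝ, E) p) : nablaEndo A p v (X p) =
      leviCivita E M (fun x => A x (X x)) p v - A p (leviCivita E M X p v) := by
  refine eq_of_smooth_tensorial (p := p) (Φ := fun X =>
    leviCivita E M (fun x => A x (X x)) p v - A p (leviCivita E M X p v)) ?_ ?_
    (smoothAt_extend_self (X p)) hX (by simp)
  · intro X Y hX hY
    have h : (fun x => A x ((X + Y) x)) = (fun x => A x (X x)) + fun x => A x (Y x) := by
      ext1 x; simp
    rw [h, leviCivita_add (hA _ hX) (hA _ hY), leviCivita_add hX hY, map_add]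
    abel
  · intro f X hf hX
    have h : (fun x => A x ((f • X) x)) = f • fun x => A x (X x) := by
      ext1 x; simp
    rw [h, leviCivita_smul hf.mdiff (hA _ hX).mdiff, leviCivita_smul hf.mdiff hX.mdiff, map_add,
      map_smul, map_smul]
    module

theorem leviCivita_endo (hA : SmoothEndoAt A p) (hX : SmoothAt X p)
    (v : TangentSpace 𝓘(ℝ, E) p) : leviCivita E M (fun x => A x (X x)) p v =
      nablaEndo A p v (X p) + A p (leviCivita E M X p v) := by
  rw [nablaEndo_apply hA hX, sub_add_cancel]

/-- The covariant derivative of a smooth endomorphism field as a bilinear map. -/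
def nablaEndoHom (hA : SmoothEndoAt A p) : TangentSpace 𝓘(ℝ, E) p →ₗ[ℝ]
    TangentSpace 𝓘(ℝ, E) p →ₗ[ℝ] TangentSpace 𝓘(ℝ, E) p :=
  LinearMap.mk₂ ℝ (nablaEndo A p)
    (by intro v v' w; simp only [nablaEndo, map_add]; abel)
    (by intro c v w; simp only [nablaEndo, map_smul]; module)
    (by
      intro v w w'
      have h1 := smoothAt_extend_self w
      have h2 := smoothAt_extend_self w'
      have h := nablaEndo_apply hA (h1.add h2) v
      have e : (fun x => A x ((FiberBundle.extend E w + FiberBundle.extend E w') x)) =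
        (fun x => A x (FiberBundle.extend E w x)) + fun x => A x (FiberBundle.extend E w' x) := by
        ext1 x; simp
      rw [e, leviCivita_add (hA _ h1) (hA _ h2), leviCivita_add h1 h2, map_add] at h
      simp only [Pi.add_apply, FiberBundle.extend_apply_self] at h
      rw [h]
      simp only [nablaEndo]
      abel)
    (by
      intro c v w
      have h1 := smoothAt_extend_self w
      have hc : SmoothFunAt (E := E) (fun _ : M => c) p := contMDiffAt_const
      have h := nablaEndo_apply hA (h1.smul hc) v
      have e : (fun x => A x (((fun _ : M => c) • FiberBundle.extend E w) x)) =
        (fun _ : M => c) • (fun x => A x (FiberBundle.extend E w x)) := by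
        ext1 x; simp
      rw [e, leviCivita_smul hc.mdiff (hA _ h1).mdiff, leviCivita_smul hc.mdiff h1.mdiff,
        mvfderiv_const] at h
      simp only [Pi.smul_apply', FiberBundle.extend_apply_self, zero_apply, zero_smul, add_zero,
        map_smul] at h
      rw [h]
      simp only [nablaEndo]
      module)

end EndomorphismFields

/-! ### Differentiating contractions in a moving orthonormal frame. -/

theorem sum_skew_frame {V : Type*} [NormedAddCommGroup V] [InnerProductSpace ℝ V] {ι : Type*}
    [Fintype ι] (e : OrthonormalBasis ι ℝ V) {β : V → V → ℝ} (hβ : IsBilinearMap ℝ β) {a : ι → V}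
    (ha : ∀ k l, (inner ℝ (a k) (e l) : ℝ) + inner ℝ (e k) (a l) = 0) :
    ∑ k, (β (a k) (e k) + β (e k) (a k)) = 0 := by
  have h1 : ∀ k, β (a k) (e k) = ∑ l, inner ℝ (e l) (a k) * β (e l) (e k) := by
    intro k
    conv_lhs => rw [← e.sum_repr' (a k)]
    exact (isBilinearMap_sum hβ _ (fun _ => 0) _ (fun _ => 0) _).1
  have h2 : ∀ k, β (e k) (a k) = ∑ l, inner ℝ (e l) (a k) * β (e k) (e l) := by
    intro k
    conv_lhs => rw [← e.sum_repr' (a k)]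
    exact (isBilinearMap_sum hβ (fun _ => 0) _ (fun _ => 0) _ _).2
  -- With `A l k = ⟨e l, a k⟩`, the sum is that of `(A l k + A k l) * β (e l) (e k)`, and `A` is
  -- skew by `ha`.
  simp only [h1, h2, Finset.sum_add_distrib]
  rw [Finset.sum_comm, ← Finset.sum_add_distrib]
  refine Finset.sum_eq_zero fun l _ => ?_
  rw [← Finset.sum_add_distrib]
  refine Finset.sum_eq_zero fun k _ => ?_
  have := ha k l
  rw [real_inner_comm] at this
  rw [← add_mul, this, zero_mul]

section

variable {X Y Z U V W : Π x : M, TangentSpace 𝓘(ℝ, E) x} {f g : M → ℝ} {p : M}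

theorem leviCivita_frame {n : ℕ} {F : Fin n → Π x : M, TangentSpace 𝓘(ℝ, E) x}
    (hF : ∀ᶠ q in 𝓝 p, IsONFrameAt F q) (v : TangentSpace 𝓘(ℝ, E) p) (k l : Fin n) :
    (inner ℝ (leviCivita E M (F k) p v) (F l p) : ℝ)
      + inner ℝ (F k p) (leviCivita E M (F l) p v) = 0 := by
  rw [← mvfderiv_inner (hF.self_of_nhds.smooth k) (hF.self_of_nhds.smooth l)]
  have h : (fun x => (inner ℝ (F k x) (F l x) : ℝ)) =ᶠ[𝓝 p] fun _ => if k = l then 1 else 0 := by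
    filter_upwards [hF] with q hq
    exact orthonormal_iff_ite.1 hq.orthonormal k l
  rw [mvfderiv_congr h, mvfderiv_const]
  rfl

/-- Differentiate `⟨R_{U,V} W, Z⟩ = -⟨R_{U,V} Z, W⟩`. The identity must hold around `p`, hence the
smoothness assumptions at nearby points. -/
theorem nablaCurv_skew (hU : ∀ᶠ q in 𝓝 p, SmoothAt U q) (hV : ∀ᶠ q in 𝓝 p, SmoothAt V q)
    (hW : ∀ᶠ q in 𝓝 p, SmoothAt W q) (hZ : ∀ᶠ q in 𝓝 p, SmoothAt Z q)
    (v : TangentSpace 𝓘(ℝ, E) p) :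
    (inner ℝ (nablaCurv p v U V W) (Z p) : ℝ) = -inner ℝ (nablaCurv p v U V Z) (W p) := by
  have h : (fun x => (inner ℝ (curv U V W x) (Z x) : ℝ)) =ᶠ[𝓝 p]
      -fun x => (inner ℝ (curv U V Z x) (W x) : ℝ) := by
    filter_upwards [hU, hV, hW, hZ] with q h1 h2 h3 h4
    have := riem_swap_right (U q) (V q) (W q) (Z q)
    rw [riem_apply, riem_apply, curvature_apply h1 h2 h3, curvature_apply h1 h2 h4] at this
    exact this
  have h1 := congrArg (fun L => L v) (mvfderiv_congr h)
  simp only [mvfderiv_neg, neg_apply] at h1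
  rw [mvfderiv_inner_curv hU.self_of_nhds hV.self_of_nhds hW.self_of_nhds hZ.self_of_nhds,
    mvfderiv_inner_curv hU.self_of_nhds hV.self_of_nhds hZ.self_of_nhds hW.self_of_nhds,
    riem_swap_right _ _ (W p) (Z p), riem_swap_right _ _ (W p) (Z p),
    riem_swap_right _ _ (leviCivita E M W p v) (Z p),
    riem_swap_right _ _ (W p) (leviCivita E M Z p v)] at h1
  linarith

theorem nablaCurv_add (v v' : TangentSpace 𝓘(ℝ, E) p) :
    nablaCurv p (v + v') U V W = nablaCurv p v U V W + nablaCurv p v' U V W := by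
  simp only [nablaCurv, map_add, curvature_add_left, curvature_add_middle, curvature_add_right]
  abel

theorem nablaCurv_smul (c : ℝ) (v : TangentSpace 𝓘(ℝ, E) p) :
    nablaCurv p (c • v) U V W = c • nablaCurv p v U V W := by
  simp only [nablaCurv, map_smul, curvature_smul_left, curvature_smul_middle,
    curvature_smul_right]
  module

end

/-! ### The almost contact structure and its first derivatives. -/

namespace AlmostContactMetric

variable (S : AlmostContactMetric E M) {X Y Z U V W : Π x : M, TangentSpace 𝓘(ℝ, E) x}
  {f g : M → ℝ} {p : M}

theorem smoothEndoAt_phi (p : M) : SmoothEndoAt S.phi p := fun _ hX =>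
  ContMDiffAt.clm_bundle_apply (F₁ := E) (F₂ := E) (E₁ := fun x : M => TangentSpace 𝓘(ℝ, E) x)
    (E₂ := fun x : M => TangentSpace 𝓘(ℝ, E) x) (S.smooth_phi p) hX

theorem smoothAt_zeta (p : M) : SmoothAt S.zeta p := S.smooth_zeta p

theorem phi_zeta (p : M) : S.phi p (S.zeta p) = 0 := by
  have := S.compatible p (S.zeta p) (S.zeta p)
  rw [S.zeta_unit] at this
  exact inner_self_eq_zero.1 (this.trans (by norm_num))

/-- Computing `φ³ v` in two ways gives results that differ by `η(φv) ζ`. -/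
theorem inner_zeta_phi (v : TangentSpace 𝓘(ℝ, E) p) : (inner ℝ (S.zeta p) (S.phi p v) : ℝ) = 0 := by
  have h1 := S.phi_sq p (S.phi p v)
  rw [S.phi_sq p v, map_add, map_neg, map_smul, S.phi_zeta] at h1
  have h2 : (inner ℝ (S.zeta p) (S.phi p v) : ℝ) • S.zeta p = 0 := by
    simpa using h1
  have h3 := congrArg (fun y => (inner ℝ (S.zeta p) y : ℝ)) h2
  rwa [inner_smul_right, S.zeta_unit, mul_one, inner_zero_right] at h3

theorem phi_skew (v w : TangentSpace 𝓘(ℝ, E) p) :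
    (inner ℝ (S.phi p v) w : ℝ) = -inner ℝ v (S.phi p w) := by
  have h := S.compatible p v (S.phi p w)
  have hz : (inner ℝ (S.phi p v) (S.zeta p) : ℝ) = 0 := by
    rw [real_inner_comm, S.inner_zeta_phi]
  rw [S.phi_sq, S.inner_zeta_phi, inner_add_right, inner_neg_right, inner_smul_right, hz] at h
  linarith

theorem nablaForm_eta (v w : TangentSpace 𝓘(ℝ, E) p) :
    nablaForm S.eta p v w = inner ℝ (leviCivita E M S.zeta p v) w := by
  have h := mvfderiv_inner (S.smoothAt_zeta p) (smoothAt_extend_self w) v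
  simp only [FiberBundle.extend_apply_self] at h
  simp only [nablaForm, eta]
  rw [h]
  ring

/-- The intrinsic torsion at a point as a bilinear map. -/
def xiHom (p : M) : TangentSpace 𝓘(ℝ, E) p →ₗ[ℝ] TangentSpace 𝓘(ℝ, E) p →ₗ[ℝ]
    TangentSpace 𝓘(ℝ, E) p :=
  LinearMap.mk₂ ℝ (S.xi p)
    (by
      intro v v' w
      have h1 : nablaEndo S.phi p (v + v') w = nablaEndo S.phi p v w + nablaEndo S.phi p v' w :=
        (nablaEndoHom (S.smoothEndoAt_phi p)).map_add₂ v v' w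
      simp only [xi, nablaForm_eta, h1, map_add, inner_add_left]
      module)
    (by
      intro c v w
      have h1 : nablaEndo S.phi p (c • v) w = c • nablaEndo S.phi p v w :=
        (nablaEndoHom (S.smoothEndoAt_phi p)).map_smul₂ c v w
      simp only [xi, nablaForm_eta, h1, map_smul, inner_smul_left, conj_trivial]
      module)
    (by
      intro v w w'
      have h1 : nablaEndo S.phi p v (w + w') = nablaEndo S.phi p v w + nablaEndo S.phi p v w' :=
        (nablaEndoHom (S.smoothEndoAt_phi p) v).map_add w w'
      simp only [xi, nablaForm_eta, h1, map_add, inner_add_right, eta]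
      module)
    (by
      intro c v w
      have h1 : nablaEndo S.phi p v (c • w) = c • nablaEndo S.phi p v w :=
        (nablaEndoHom (S.smoothEndoAt_phi p) v).map_smul c w
      simp only [xi, nablaForm_eta, h1, map_smul, inner_smul_right, eta]
      module)

/-- Differentiating the skewness of `φ`, the formula for `φ²`, `φζ = 0` and `|ζ|² = 1` gives
`B_skew`, `B_anti`, `B_zeta` and `t_zeta` respectively. -/
theorem isAlmostContactPoint (p : M) : IsAlmostContactPoint (S.phi p).toLinearMap (S.zeta p)
    (nablaEndoHom (S.smoothEndoAt_phi p)) (S.xiHom p) (leviCivita E M S.zeta p).toLinearMap where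
  skew := S.phi_skew
  sq := S.phi_sq p
  map_zeta := S.phi_zeta p
  B_skew := by
    intro x v w
    change (inner ℝ (nablaEndo S.phi p x v) w : ℝ) = -inner ℝ v (nablaEndo S.phi p x w)
    have hv := smoothAt_extend_self v
    have hw := smoothAt_extend_self w
    have h : (fun q => (inner ℝ (S.phi q (FiberBundle.extend E v q))
        (FiberBundle.extend E w q) : ℝ)) =
        -fun q => inner ℝ (FiberBundle.extend E v q) (S.phi q (FiberBundle.extend E w q)) := by
      ext1 q
      exact S.phi_skew _ _
    have h1 := congrArg (fun k => mvfderiv 𝓘(ℝ, E) k p x) h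
    simp only [mvfderiv_neg, neg_apply] at h1
    rw [mvfderiv_inner (S.smoothEndoAt_phi p _ hv) hw, mvfderiv_inner hv (S.smoothEndoAt_phi p _ hw),
      leviCivita_endo (S.smoothEndoAt_phi p) hv, leviCivita_endo (S.smoothEndoAt_phi p) hw,
      inner_add_left, inner_add_right, S.phi_skew (leviCivita E M _ p x)] at h1
    simp only [FiberBundle.extend_apply_self] at h1
    rw [S.phi_skew v] at h1
    linarith
  B_anti := by
    intro x w
    change nablaEndo S.phi p x (S.phi p w) + S.phi p (nablaEndo S.phi p x w) =
      (inner ℝ (leviCivita E M S.zeta p x) w : ℝ) • S.zeta p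
        + (inner ℝ (S.zeta p) w : ℝ) • leviCivita E M S.zeta p x
    have hw := smoothAt_extend_self w
    have hφ := S.smoothEndoAt_phi p
    have hz := S.smoothAt_zeta p
    have h : (fun q => S.phi q (S.phi q (FiberBundle.extend E w q))) =
        -(FiberBundle.extend E w) +
          (fun q => (inner ℝ (S.zeta q) (FiberBundle.extend E w q) : ℝ)) • S.zeta := by
      ext1 q
      exact S.phi_sq q _
    have h1 := congrArg (fun k => leviCivita E M k p x) h
    rw [leviCivita_endo hφ (hφ _ hw), leviCivita_endo hφ hw,
      leviCivita_add hw.neg (hz.smul (hz.inner hw)), leviCivita_neg hw,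
      leviCivita_smul (hz.inner hw).mdiff hz.mdiff, mvfderiv_inner hz hw, map_add, S.phi_sq] at h1
    simp only [FiberBundle.extend_apply_self] at h1
    linear_combination (norm := module) (1 : ℝ) • h1
  B_zeta := by
    intro x
    change nablaEndo S.phi p x (S.zeta p) = -S.phi p (leviCivita E M S.zeta p x)
    have hφ := S.smoothEndoAt_phi p
    have hz := S.smoothAt_zeta p
    have h : (fun q => S.phi q (S.zeta q)) = (0 : ℝ) • S.zeta := by
      ext1 q
      simp [S.phi_zeta]
    have h1 := congrArg (fun k => leviCivita E M k p x) h
    rw [leviCivita_endo hφ hz,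
      (leviCivita E M).isCovariantDerivativeOnUniv.smul_const 0 hz.mdiff, zero_smul] at h1
    exact eq_neg_of_add_eq_zero_left h1
  t_zeta := by
    intro x
    have hz := S.smoothAt_zeta p
    have h : (fun q => (inner ℝ (S.zeta q) (S.zeta q) : ℝ)) = fun _ => 1 := by
      ext1 q
      exact S.zeta_unit q
    have h1 := mvfderiv_inner hz hz x
    rw [h, mvfderiv_const, real_inner_comm] at h1
    change 0 = _ at h1
    change (inner ℝ (S.zeta p) (leviCivita E M S.zeta p x) : ℝ) = 0
    linarith
  xi_eq := by
    intro x w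
    change S.xi p x w = _
    rw [xi, nablaForm_eta]
    rfl

/-- Both components of `ξ` vanish in the direction `ζ`, while the formula for `ξ` gives `ξ_ζ ζ =
-∇_ζ ζ`. -/
theorem leviCivita_zeta_zeta (hS : S.IsTypeC1toC10) (p : M) :
    leviCivita E M S.zeta p (S.zeta p) = 0 := by
  obtain ⟨a, b, ha, hb, hab⟩ := hS p
  have h0 : S.xi p (S.zeta p) (S.zeta p) = 0 := by
    rw [hab, ha.1, hb.1]
    simp
  have h := S.isAlmostContactPoint p
  have h1 : S.xiHom p (S.zeta p) (S.zeta p) = 0 := h0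
  have ht := h.t_zeta (S.zeta p)
  rw [real_inner_comm] at ht
  rw [h.xi_eq, h.B_zeta, map_neg, h.sq, real_inner_comm, ht, S.zeta_unit] at h1
  change (leviCivita E M S.zeta p).toLinearMap (S.zeta p) = 0
  linear_combination (norm := module) (-1 : ℝ) • h1

theorem ricAc_eq {ι : Type*} [Fintype ι] (e : OrthonormalBasis ι ℝ (TangentSpace 𝓘(ℝ, E) p))
    (v w : TangentSpace 𝓘(ℝ, E) p) :
    S.ricAc p v w = ∑ i, riem p (e i) v (S.phi p (e i)) (S.phi p w) :=
  sum_orthonormalBasis (frame p) e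
    (β := fun u u' => riem p u v (S.phi p u') (S.phi p w)) (by constructor <;> intros <;> simp)

theorem scalAc_eq {ι : Type*} [Fintype ι] (e : OrthonormalBasis ι ℝ (TangentSpace 𝓘(ℝ, E) p)) :
    S.scalAc p = ∑ i, ∑ k, riem p (e k) (e i) (S.phi p (e k)) (S.phi p (e i)) := by
  simp only [scalAc, S.ricAc_eq e]
  exact sum_orthonormalBasis (frame p) e
    (β := fun u u' => ∑ k, riem p (e k) u (S.phi p (e k)) (S.phi p u'))
    (by constructor <;> intros <;> simp [Finset.sum_add_distrib, Finset.mul_sum])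

theorem codiffBilin_fund {ι : Type*} [Fintype ι]
    (e : OrthonormalBasis ι ℝ (TangentSpace 𝓘(ℝ, E) p)) :
    codiffBilin S.fund p (S.zeta p) = inner ℝ (S.zeta p) (∑ j, nablaEndo S.phi p (e j) (e j)) := by
  have h1 : ∀ v u w, nablaBilin S.fund p v u w = inner ℝ u (nablaEndo S.phi p v w) := by
    intro v u w
    have hu := smoothAt_extend_self u
    have hw := smoothAt_extend_self w
    have hφ := S.smoothEndoAt_phi p
    have h := mvfderiv_inner hu (hφ _ hw) v
    rw [leviCivita_endo hφ hw] at h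
    simp only [FiberBundle.extend_apply_self, inner_add_right] at h
    simp only [nablaBilin, fund]
    rw [h]
    ring
  have h2 : ∀ v w, (inner ℝ w (nablaEndo S.phi p v (S.zeta p)) : ℝ) =
      -inner ℝ (S.zeta p) (nablaEndo S.phi p v w) := by
    intro v w
    rw [real_inner_comm]
    exact (S.isAlmostContactPoint p).B_skew v (S.zeta p) w
  simp only [codiffBilin, h1, h2, Finset.sum_neg_distrib, neg_neg, inner_sum]
  exact sum_orthonormalBasis (frame p) e
    (β := fun u u' => inner ℝ (S.zeta p) (nablaEndoHom (S.smoothEndoAt_phi p) u u'))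
    (by constructor <;> intros <;> simp [inner_add_right, inner_smul_right])

theorem codiffForm_eta {ι : Type*} [Fintype ι]
    (e : OrthonormalBasis ι ℝ (TangentSpace 𝓘(ℝ, E) p)) :
    codiffForm S.eta p = -∑ j, inner ℝ (leviCivita E M S.zeta p (e j)) (e j) := by
  simp only [codiffForm, nablaForm_eta]
  rw [neg_inj]
  exact sum_orthonormalBasis (frame p) e
    (β := fun u u' => inner ℝ (leviCivita E M S.zeta p u) u')
    (by constructor <;> intros <;>
      simp [inner_add_right, inner_smul_right, inner_add_left, inner_smul_left])

end AlmostContactMetric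

/-! ### Derivatives of `Ric^ac` and `s^ac`, and the divergence formula. -/

namespace AlmostContactMetric

variable (S : AlmostContactMetric E M) {p : M} {m : ℕ}
  {F : Fin m → Π x : M, TangentSpace 𝓘(ℝ, E) x}

theorem eventually_smoothAt_phi {X : Π x : M, TangentSpace 𝓘(ℝ, E) x}
    (hX : ∀ᶠ q in 𝓝 p, SmoothAt X q) : ∀ᶠ q in 𝓝 p, SmoothAt (fun x => S.phi x (X x)) q :=
  hX.mono fun q h => S.smoothEndoAt_phi q X h

theorem eventually_smoothAt_frame (hF : ∀ᶠ q in 𝓝 p, IsONFrameAt F q) (k : Fin m) :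
    ∀ᶠ q in 𝓝 p, SmoothAt (F k) q := hF.mono fun _ h => h.smooth k

/-- The last two groups pair the derivatives of `U, W` and of `V, Z`. When a pair is a single frame
field, `sum_frame_derivative` makes its group sum to zero. -/
theorem mvfderiv_inner_curv_phi {U V W Z : Π x : M, TangentSpace 𝓘(ℝ, E) x}
    (hU : SmoothAt U p) (hV : SmoothAt V p) (hW : SmoothAt W p) (hZ : SmoothAt Z p)
    (v : TangentSpace 𝓘(ℝ, E) p) :
    mvfderiv 𝓘(ℝ, E) (fun x => (inner ℝ (curv U V (fun y => S.phi y (W y)) x)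
        (S.phi x (Z x)) : ℝ)) p v =
      inner ℝ (nablaCurv p v U V (fun y => S.phi y (W y))) (S.phi p (Z p))
        + riem p (U p) (V p) (nablaEndo S.phi p v (W p)) (S.phi p (Z p))
        + riem p (U p) (V p) (S.phi p (W p)) (nablaEndo S.phi p v (Z p))
        + (riem p (leviCivita E M U p v) (V p) (S.phi p (W p)) (S.phi p (Z p))
          + riem p (U p) (V p) (S.phi p (leviCivita E M W p v)) (S.phi p (Z p)))
        + (riem p (U p) (leviCivita E M V p v) (S.phi p (W p)) (S.phi p (Z p))
          + riem p (U p) (V p) (S.phi p (W p)) (S.phi p (leviCivita E M Z p v))) := by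
  have hφ := S.smoothEndoAt_phi p
  rw [mvfderiv_inner_curv hU hV (hφ _ hW) (hφ _ hZ), leviCivita_endo hφ hW,
    leviCivita_endo hφ hZ, map_add, map_add, LinearMap.add_apply]
  ring

/-- The basis `frame q` is chosen separately at each `q`, so the contraction is rewritten in a
smooth frame before being differentiated. -/
theorem ricAcT_eventuallyEq (hF : ∀ᶠ q in 𝓝 p, IsONFrameAt F q)
    (hm : Fintype.card (Fin m) = Module.finrank ℝ E) {U X : Π x : M, TangentSpace 𝓘(ℝ, E) x}
    (hX : ∀ᶠ q in 𝓝 p, SmoothAt X q) :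
    (fun q => S.ricAcT q (U q) (X q)) =ᶠ[𝓝 p] fun q =>
      ∑ k, inner ℝ (curv (F k) X (fun y => S.phi y (F k y)) q) (S.phi q (U q)) := by
  filter_upwards [hF, hX] with q h1 h2
  rw [ricAcT, S.ricAc_eq (h1.basis hm)]
  refine Finset.sum_congr rfl fun k _ => ?_
  rw [IsONFrameAt.basis_apply, riem_apply,
    ← curvature_apply (h1.smooth k) h2 (S.smoothEndoAt_phi q _ (h1.smooth k))]

theorem scalAc_eventuallyEq (hF : ∀ᶠ q in 𝓝 p, IsONFrameAt F q)
    (hm : Fintype.card (Fin m) = Module.finrank ℝ E) :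
    S.scalAc =ᶠ[𝓝 p] fun q => ∑ i, ∑ k,
      inner ℝ (curv (F k) (F i) (fun y => S.phi y (F k y)) q) (S.phi q (F i q)) := by
  filter_upwards [hF] with q h1
  rw [S.scalAc_eq (h1.basis hm)]
  refine Finset.sum_congr rfl fun i _ => Finset.sum_congr rfl fun k _ => ?_
  rw [IsONFrameAt.basis_apply, IsONFrameAt.basis_apply, riem_apply,
    ← curvature_apply (h1.smooth k) (h1.smooth i) (S.smoothEndoAt_phi q _ (h1.smooth k))]

/-- Connection coefficients of an orthonormal frame are skew, so derivatives of the frame drop out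
of contractions. This replaces the choice of a frame parallel at `p`. -/
theorem sum_frame_derivative (hF : ∀ᶠ q in 𝓝 p, IsONFrameAt F q)
    (hm : Fintype.card (Fin m) = Module.finrank ℝ E)
    {β : TangentSpace 𝓘(ℝ, E) p → TangentSpace 𝓘(ℝ, E) p → ℝ} (hβ : IsBilinearMap ℝ β)
    (v : TangentSpace 𝓘(ℝ, E) p) :
    ∑ k, (β (leviCivita E M (F k) p v) (F k p) + β (F k p) (leviCivita E M (F k) p v)) = 0 := by
  have h := sum_skew_frame (hF.self_of_nhds.basis hm) hβ
    (a := fun k => leviCivita E M (F k) p v) fun k l => by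
      simpa using leviCivita_frame hF v k l
  simpa using h

/-- The covariant derivative of the transposed almost contact Ricci tensor in a local frame. -/
theorem nablaBilin_ricAcT (hF : ∀ᶠ q in 𝓝 p, IsONFrameAt F q)
    (hm : Fintype.card (Fin m) = Module.finrank ℝ E) (v u x : TangentSpace 𝓘(ℝ, E) p) :
    nablaBilin S.ricAcT p v u x =
      ∑ k, (inner ℝ (nablaCurv p v (F k) (FiberBundle.extend E x) (fun y => S.phi y (F k y)))
          (S.phi p u)
        + riem p (F k p) x (nablaEndo S.phi p v (F k p)) (S.phi p u)
        + riem p (F k p) x (S.phi p (F k p)) (nablaEndo S.phi p v u)) := by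
  have hφ := S.smoothEndoAt_phi p
  have hX := smoothAt_extend x
  have hU := smoothAt_extend_self u
  have hFp := hF.self_of_nhds
  simp only [nablaBilin]
  rw [mvfderiv_congr (S.ricAcT_eventuallyEq hF hm (U := FiberBundle.extend E u) hX),
    (mvfderiv_sum _ (fun k _ => ((smoothAt_curv (hFp.smooth k) hX.self_of_nhds
      (hφ _ (hFp.smooth k))).inner (hφ _ hU)).mdiff) v).2]
  simp only [S.mvfderiv_inner_curv_phi (hFp.smooth _) hX.self_of_nhds (hFp.smooth _) hU,
    FiberBundle.extend_apply_self, Finset.sum_add_distrib]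
  have h0 := sum_frame_derivative hF hm
    (β := fun a b => riem p a x (S.phi p b) (S.phi p u))
    (by constructor <;> intros <;> simp) v
  simp only [ricAcT, S.ricAc_eq (hFp.basis hm), IsONFrameAt.basis_apply]
  simp only [Finset.sum_add_distrib] at h0
  linarith

/-- The codifferential of the transposed almost contact Ricci tensor in a local frame. -/
theorem codiffBilin_ricAcT (hF : ∀ᶠ q in 𝓝 p, IsONFrameAt F q)
    (hm : Fintype.card (Fin m) = Module.finrank ℝ E) (x : TangentSpace 𝓘(ℝ, E) p) :
    codiffBilin S.ricAcT p x =
      -∑ j, ∑ k, (inner ℝ (nablaCurv p (F j p) (F k) (FiberBundle.extend E x)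
            (fun y => S.phi y (F k y))) (S.phi p (F j p))
        + riem p (F k p) x (nablaEndo S.phi p (F j p) (F k p)) (S.phi p (F j p))
        + riem p (F k p) x (S.phi p (F k p)) (nablaEndo S.phi p (F j p) (F j p))) := by
  -- Bilinearity in `(v, u)`, with the fields in the curvature slots held fixed, allows the
  -- contraction over `frame p` to be taken over `F`.
  have hb : IsBilinearMap ℝ fun v u : TangentSpace 𝓘(ℝ, E) p =>
      ∑ k, (inner ℝ (nablaCurv p v (F k) (FiberBundle.extend E x) (fun y => S.phi y (F k y)))
          (S.phi p u)
        + riem p (F k p) x (nablaEndoHom (S.smoothEndoAt_phi p) v (F k p)) (S.phi p u)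
        + riem p (F k p) x (S.phi p (F k p)) (nablaEndoHom (S.smoothEndoAt_phi p) v u)) := by
    constructor <;> intros <;>
      simp only [nablaCurv_add, nablaCurv_smul, map_add, map_smul, LinearMap.add_apply,
        LinearMap.smul_apply, inner_add_left, inner_add_right, inner_smul_left, inner_smul_right,
        Finset.mul_sum, smul_eq_mul, ← Finset.sum_add_distrib, conj_trivial] <;>
      exact Finset.sum_congr rfl fun _ _ => by ring
  have h := sum_orthonormalBasis (frame p) (hF.self_of_nhds.basis hm) hb
  simp only [IsONFrameAt.basis_apply] at h
  simp only [codiffBilin, S.nablaBilin_ricAcT hF hm]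
  exact congrArg Neg.neg h

theorem mdifferentiableAt_scalAc (p : M) : MDiffAt S.scalAc p := by
  obtain ⟨F, -, hF⟩ := exists_orthonormal_frame (stdOrthonormalBasis ℝ (TangentSpace 𝓘(ℝ, E) p))
  have hφ := S.smoothEndoAt_phi p
  have hFp := hF.self_of_nhds
  refine MDifferentiableAt.congr_of_eventuallyEq ?_ (S.scalAc_eventuallyEq hF (by simp; rfl))
  exact (mvfderiv_sum _ (fun i _ => (mvfderiv_sum _ (fun k _ => ((smoothAt_curv (hFp.smooth k)
    (hFp.smooth i) (hφ _ (hFp.smooth k))).inner (hφ _ (hFp.smooth i))).mdiff) 0).1) 0).1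

/-- The differential of the ac-scalar curvature in a local frame. -/
theorem mvfderiv_scalAc (hF : ∀ᶠ q in 𝓝 p, IsONFrameAt F q)
    (hm : Fintype.card (Fin m) = Module.finrank ℝ E) (x : TangentSpace 𝓘(ℝ, E) p) :
    mvfderiv 𝓘(ℝ, E) S.scalAc p x =
      ∑ i, ∑ k, inner ℝ (nablaCurv p x (F k) (F i) (fun y => S.phi y (F k y))) (S.phi p (F i p))
        + 2 * ∑ i, ∑ k, riem p (F i p) (F k p) (nablaEndo S.phi p x (F i p)) (S.phi p (F k p)) := by
  have hφ := S.smoothEndoAt_phi p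
  have hFp := hF.self_of_nhds
  have hd : ∀ i k, MDiffAt (fun q => (inner ℝ (curv (F k) (F i) (fun y => S.phi y (F k y)) q)
      (S.phi q (F i q)) : ℝ)) p := fun i k => ((smoothAt_curv (hFp.smooth k)
    (hFp.smooth i) (hφ _ (hFp.smooth k))).inner (hφ _ (hFp.smooth i))).mdiff
  rw [mvfderiv_congr (S.scalAc_eventuallyEq hF hm),
    (mvfderiv_sum _ (fun i _ => (mvfderiv_sum _ (fun k _ => hd i k) x).1) x).2,
    Finset.sum_congr rfl fun i _ => (mvfderiv_sum _ (fun k _ => hd i k) x).2]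
  simp only [S.mvfderiv_inner_curv_phi (hFp.smooth _) (hFp.smooth _) (hFp.smooth _) (hFp.smooth _),
    Finset.sum_add_distrib]
  have h1 : ∀ i, ∑ k, (riem p (leviCivita E M (F k) p x) (F i p) (S.phi p (F k p))
        (S.phi p (F i p)) + riem p (F k p) (F i p) (S.phi p (leviCivita E M (F k) p x))
          (S.phi p (F i p))) = 0 := fun i =>
    sum_frame_derivative hF hm (β := fun a b => riem p a (F i p) (S.phi p b) (S.phi p (F i p)))
      (by constructor <;> intros <;> simp) x
  have h2 : ∀ k, ∑ i, (riem p (F k p) (leviCivita E M (F i) p x) (S.phi p (F k p))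
        (S.phi p (F i p)) + riem p (F k p) (F i p) (S.phi p (F k p))
          (S.phi p (leviCivita E M (F i) p x))) = 0 := fun k =>
    sum_frame_derivative hF hm (β := fun a b => riem p (F k p) a (S.phi p (F k p)) (S.phi p b))
      (by constructor <;> intros <;> simp) x
  have h1' := Finset.sum_eq_zero fun i (_ : i ∈ Finset.univ) => h1 i
  have h2' := Finset.sum_eq_zero fun i (_ : i ∈ Finset.univ) => h2 i
  rw [Finset.sum_comm] at h2'
  simp only [Finset.sum_add_distrib] at h1' h2'
  -- The two terms in `∇φ` agree after relabelling and swapping both pairs of `R`, whence the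
  -- coefficient `2`.
  have h3 : ∑ i, ∑ k, riem p (F k p) (F i p) (nablaEndo S.phi p x (F k p)) (S.phi p (F i p)) =
      ∑ i, ∑ k, riem p (F i p) (F k p) (nablaEndo S.phi p x (F i p)) (S.phi p (F k p)) :=
    Finset.sum_comm
  have h4 : ∑ i, ∑ k, riem p (F k p) (F i p) (S.phi p (F k p)) (nablaEndo S.phi p x (F i p)) =
      ∑ i, ∑ k, riem p (F i p) (F k p) (nablaEndo S.phi p x (F i p)) (S.phi p (F k p)) := by
    refine Finset.sum_congr rfl fun i _ => Finset.sum_congr rfl fun k _ => ?_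
    rw [riem_swap_left, riem_swap_right, neg_neg]
  linarith

/-- The contracted second Bianchi identity. -/
theorem sum_nablaCurv (hF : ∀ᶠ q in 𝓝 p, IsONFrameAt F q) (x : TangentSpace 𝓘(ℝ, E) p) :
    ∑ i, ∑ k, (inner ℝ (nablaCurv p x (F k) (F i) (fun y => S.phi y (F k y)))
        (S.phi p (F i p)) : ℝ) =
      2 * ∑ j, ∑ k, inner ℝ (nablaCurv p (F j p) (F k) (FiberBundle.extend E x)
            (fun y => S.phi y (F k y))) (S.phi p (F j p)) := by
  have hφ := S.smoothEndoAt_phi p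
  have hX := smoothAt_extend x
  have hFp := hF.self_of_nhds
  -- The second Bianchi identity on `X, F k, F i`, with skewness in the last pair, splits the term
  -- into two that are exchanged by `i ↔ k`; summation doubles one of them.
  have h1 : ∀ i k, (inner ℝ (nablaCurv p x (F k) (F i) (fun y => S.phi y (F k y)))
      (S.phi p (F i p)) : ℝ) =
        inner ℝ (nablaCurv p (F k p) (F i) (FiberBundle.extend E x) (fun y => S.phi y (F i y)))
          (S.phi p (F k p))
        + inner ℝ (nablaCurv p (F i p) (F k) (FiberBundle.extend E x) (fun y => S.phi y (F k y)))
          (S.phi p (F i p)) := by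
    intro i k
    have hb := second_bianchi hX.self_of_nhds (hFp.smooth k) (hFp.smooth i) (hφ _ (hFp.smooth k))
    simp only [FiberBundle.extend_apply_self] at hb
    have hs := nablaCurv_skew (eventually_smoothAt_frame hF i) hX
      (S.eventually_smoothAt_phi (eventually_smoothAt_frame hF k))
      (S.eventually_smoothAt_phi (eventually_smoothAt_frame hF i)) (F k p)
    have hsw := nablaCurv_swap hX.self_of_nhds (hFp.smooth k) (hφ _ (hFp.smooth k)) (F i p)
    rw [hsw] at hb
    have hb' := congrArg (fun y => (inner ℝ y (S.phi p (F i p)) : ℝ)) hb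
    simp only [inner_add_left, inner_neg_left, inner_zero_left] at hb'
    linarith
  simp only [h1, Finset.sum_add_distrib]
  rw [Finset.sum_comm]
  ring

/-- The divergence formula for the almost contact Ricci tensor. -/
theorem two_mul_codiffBilin_ricAcT_add (hS : S.IsTypeC1toC10)
    (e : OrthonormalBasis (Fin m) ℝ (TangentSpace 𝓘(ℝ, E) p)) (x : TangentSpace 𝓘(ℝ, E) p) :
    2 * codiffBilin S.ricAcT p x + mvfderiv 𝓘(ℝ, E) S.scalAc p x =
      2 * (∑ i, ∑ j, (inner ℝ (curvature p (e i) x (e j))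
            (S.xi p (S.phi p (e i)) (S.phi p (e j))) : ℝ))
          - 4 * S.ricAc p x (∑ i, S.xi p (e i) (e i))
          + 4 * (∑ i, ∑ j, S.ricAc p (e i) (e j) * (inner ℝ (S.xi p x (e i)) (e j) : ℝ))
          - 2 * codiffBilin S.fund p (S.zeta p) * S.ricAc p (S.zeta p) (S.phi p x) := by
  obtain ⟨F, hFe, hF⟩ := exists_orthonormal_frame e
  have hm : Fintype.card (Fin m) = Module.finrank ℝ E :=
    (Module.finrank_eq_card_basis e.toBasis).symm
  have hc := (S.isAlmostContactPoint p).contracted_identity (isCurvatureTensor_riem p)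
    (S.leviCivita_zeta_zeta hS p) e x
  have h1 : ∀ i, ∑ j, S.ricAc p (e i) (e j) * (inner ℝ (S.xi p x (e i)) (e j) : ℝ) =
      S.ricAc p (e i) (S.xi p x (e i)) := by
    intro i
    conv_rhs => rw [← e.sum_repr' (S.xi p x (e i))]
    simp only [S.ricAc_eq e, map_sum, map_smul, smul_eq_mul, Finset.sum_mul]
    rw [Finset.sum_comm]
    refine Finset.sum_congr rfl fun j _ => Finset.sum_congr rfl fun k _ => ?_
    rw [real_inner_comm, mul_comm]
  simp only [h1]
  rw [S.codiffBilin_fund e, S.codiffBilin_ricAcT hF hm, S.mvfderiv_scalAc hF hm,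
    S.sum_nablaCurv hF]
  simp only [S.ricAc_eq e, hFe, Finset.sum_add_distrib]
  have h2 : ∑ j, ∑ k, riem p (e k) x (nablaEndo S.phi p (e j) (e k)) (S.phi p (e j)) =
      ∑ k, ∑ j, riem p (e k) x (nablaEndo S.phi p (e j) (e k)) (S.phi p (e j)) :=
    Finset.sum_comm
  have h3 : ∑ j, ∑ k, riem p (e k) x (S.phi p (e k)) (nablaEndo S.phi p (e j) (e j)) =
      ∑ k, riem p (e k) x (S.phi p (e k)) (∑ j, nablaEndo S.phi p (e j) (e j)) := by
    rw [Finset.sum_comm]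
    simp only [map_sum]
  rw [h2, h3]
  -- The `∇R` sums now cancel, and the remainder is the left side of `contracted_identity`.
  refine Eq.trans ?_ hc
  change _ = 2 * ∑ i, ∑ j, riem p (e i) (e j) (nablaEndo S.phi p x (e i)) (S.phi p (e j))
        - 2 * ∑ i, ∑ j, riem p (e i) x (nablaEndo S.phi p (e j) (e i)) (S.phi p (e j))
        - 2 * ∑ i, riem p (e i) x (S.phi p (e i)) (∑ j, nablaEndo S.phi p (e j) (e j))
  ring

/-! ### The weakly-ac-Einstein case. -/

/-- The covariant derivative of a weakly-ac-Einstein Ricci tensor. -/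
theorem nablaBilin_ricAcT_of_einstein {n : ℕ} (hE : S.IsWeaklyAcEinstein n)
    (v u x : TangentSpace 𝓘(ℝ, E) p) :
    nablaBilin S.ricAcT p v u x = 1 / (2 * n : ℝ) *
      (mvfderiv 𝓘(ℝ, E) S.scalAc p v * (inner ℝ u x - S.eta p u * S.eta p x)
        - S.scalAc p * (inner ℝ (leviCivita E M S.zeta p v) u * S.eta p x
          + S.eta p u * inner ℝ (leviCivita E M S.zeta p v) x)) := by
  have hX := smoothAt_extend_self x
  have hU := smoothAt_extend_self u
  have hz := S.smoothAt_zeta p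
  have hs := S.mdifferentiableAt_scalAc p
  set c : ℝ := 1 / (2 * n : ℝ) with hcdef
  let h : M → ℝ := fun q => inner ℝ (FiberBundle.extend E u q) (FiberBundle.extend E x q)
  let a : M → ℝ := fun q => inner ℝ (S.zeta q) (FiberBundle.extend E u q)
  let b : M → ℝ := fun q => inner ℝ (S.zeta q) (FiberBundle.extend E x q)
  have hh : MDiffAt h p := (hU.inner hX).mdiff
  have ha : MDiffAt a p := (hz.inner hU).mdiff
  have hb : MDiffAt b p := (hz.inner hX).mdiff
  have hT : (fun q => S.ricAcT q (FiberBundle.extend E u q) (FiberBundle.extend E x q)) =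
      c • (S.scalAc * (h - a * b)) := by
    ext1 q
    simp only [ricAcT, hE q, eta, Pi.smul_apply, Pi.mul_apply, Pi.sub_apply, smul_eq_mul, h, a, b]
    rw [real_inner_comm]
    ring
  have hd : mvfderiv 𝓘(ℝ, E) (c • (S.scalAc * (h - a * b))) p v =
      c * (S.scalAc p * (mvfderiv 𝓘(ℝ, E) h p v - (a p * mvfderiv 𝓘(ℝ, E) b p v
        + b p * mvfderiv 𝓘(ℝ, E) a p v)) + (h p - a p * b p) * mvfderiv 𝓘(ℝ, E) S.scalAc p v) := by
    have hc : MDiffAt (fun _ : M => c) p := mdifferentiableAt_const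
    have : c • (S.scalAc * (h - a * b)) = (fun _ : M => c) * (S.scalAc * (h - a * b)) := rfl
    rw [this, mvfderiv_mul hc (hs.mul (hh.sub (ha.mul hb))), mvfderiv_mul hs (hh.sub (ha.mul hb)),
      mvfderiv_sub hh (ha.mul hb), mvfderiv_mul ha hb, mvfderiv_const]
    simp
    ring
  simp only [nablaBilin]
  rw [hT, hd, mvfderiv_inner hU hX, mvfderiv_inner hz hX, mvfderiv_inner hz hU]
  simp only [ricAcT, hE p, ← hcdef, h, a, b, FiberBundle.extend_apply_self, eta]
  rw [real_inner_comm (leviCivita E M (FiberBundle.extend E u) p v) x,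
    real_inner_comm u (leviCivita E M (FiberBundle.extend E x) p v)]
  ring

/-- In the trace, the part of `∇η` contracted with `η` is `⟨∇_ζ ζ, x⟩ = 0`, and `⟨∇_{e_i} ζ, e_i⟩`
sums to `-d^*η`. -/
theorem codiffBilin_ricAcT_of_einstein (hS : S.IsTypeC1toC10) {n : ℕ}
    (hE : S.IsWeaklyAcEinstein n) (x : TangentSpace 𝓘(ℝ, E) p) :
    codiffBilin S.ricAcT p x = -(1 / (2 * n : ℝ) *
      (mvfderiv 𝓘(ℝ, E) S.scalAc p x - mvfderiv 𝓘(ℝ, E) S.scalAc p (S.zeta p) * S.eta p x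
        + S.scalAc p * codiffForm S.eta p * S.eta p x)) := by
  have hL : ∀ (L : TangentSpace 𝓘(ℝ, E) p →ₗ[ℝ] ℝ) (y : TangentSpace 𝓘(ℝ, E) p),
      ∑ i, L (frame p i) * inner ℝ (frame p i) y = L y := by
    intro L y
    conv_rhs => rw [← (frame p).sum_repr' y]
    simp [mul_comm]
  have h1 := hL (mvfderiv 𝓘(ℝ, E) S.scalAc p).toLinearMap x
  have h2 := hL (mvfderiv 𝓘(ℝ, E) S.scalAc p).toLinearMap (S.zeta p)
  have h3 := hL ((innerₗ _ x) ∘ₗ (leviCivita E M S.zeta p).toLinearMap) (S.zeta p)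
  have h4 := S.codiffForm_eta (frame p)
  simp only [LinearMap.comp_apply, innerₗ_apply_apply, ContinuousLinearMap.coe_coe,
    S.leviCivita_zeta_zeta hS p, inner_zero_right] at h1 h2 h3
  have h5 : ∀ i, nablaBilin S.ricAcT p (frame p i) (frame p i) x = 1 / (2 * n : ℝ) *
      (mvfderiv 𝓘(ℝ, E) S.scalAc p (frame p i) * inner ℝ (frame p i) x
        - mvfderiv 𝓘(ℝ, E) S.scalAc p (frame p i) * inner ℝ (frame p i) (S.zeta p) * S.eta p x
        - S.scalAc p * (inner ℝ (leviCivita E M S.zeta p (frame p i)) (frame p i) * S.eta p x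
        + inner ℝ x (leviCivita E M S.zeta p (frame p i)) * inner ℝ (frame p i) (S.zeta p))) := by
    intro i
    rw [S.nablaBilin_ricAcT_of_einstein hE,
      real_inner_comm x (leviCivita E M S.zeta p (frame p i)),
      real_inner_comm (S.zeta p) (frame p i)]
    simp only [eta]
    ring
  simp only [codiffBilin, h5, ← Finset.mul_sum, Finset.sum_sub_distrib, Finset.sum_add_distrib,
    ← Finset.sum_mul]
  rw [h1, h2, h3, h4]
  ring

end AlmostContactMetric

namespace AlmostContactMetric

variable (S : AlmostContactMetric E M) {p : M} {m : ℕ}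

/-- From `ξ_v ζ = -∇_v ζ` and skewness, `η(ξ_v v) = ⟨∇_v ζ, v⟩`, whose trace is `-d^*η`. -/
theorem inner_zeta_sum_xi (e : OrthonormalBasis (Fin m) ℝ (TangentSpace 𝓘(ℝ, E) p)) :
    (inner ℝ (S.zeta p) (∑ i, S.xi p (e i) (e i)) : ℝ) = -codiffForm S.eta p := by
  have h := S.isAlmostContactPoint p
  have h1 : ∀ v, (inner ℝ (S.zeta p) (S.xi p v v) : ℝ) =
      inner ℝ (leviCivita E M S.zeta p v) v := by
    intro v
    have h2 : (inner ℝ (S.xiHom p v v) (S.zeta p) : ℝ) = -inner ℝ v (S.xiHom p v (S.zeta p)) :=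
      h.xi_skew v v (S.zeta p)
    have ht := h.t_zeta v
    have ht' := ht
    rw [real_inner_comm] at ht'
    rw [h.xi_eq v (S.zeta p), h.B_zeta, map_neg, h.sq, ht, ht', S.zeta_unit, real_inner_comm] at h2
    refine h2.trans ?_
    simp only [inner_add_right, inner_sub_right, inner_neg_right, inner_smul_right, smul_neg]
    rw [real_inner_comm v]
    simp only [ContinuousLinearMap.coe_coe]
    ring
  rw [S.codiffForm_eta e, neg_neg, inner_sum]
  exact Finset.sum_congr rfl fun i _ => h1 _

/-- The Einstein equation makes `Ric^ac` symmetric, and `ξ_x` is skew. -/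
theorem sum_ricAc_mul_xi_of_einstein {n : ℕ} (hE : S.IsWeaklyAcEinstein n)
    (e : OrthonormalBasis (Fin m) ℝ (TangentSpace 𝓘(ℝ, E) p)) (x : TangentSpace 𝓘(ℝ, E) p) :
    ∑ i, ∑ j, S.ricAc p (e i) (e j) * (inner ℝ (S.xi p x (e i)) (e j) : ℝ) = 0 := by
  have hskew : ∀ v w, (inner ℝ (S.xi p x v) w : ℝ) = -inner ℝ (S.xi p x w) v := by
    intro v w
    rw [real_inner_comm v]
    exact (S.isAlmostContactPoint p).xi_skew x v w
  have hsymm : ∀ v w, S.ricAc p v w = S.ricAc p w v := by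
    intro v w
    rw [hE, hE, real_inner_comm]
    ring
  have h : ∑ i, ∑ j, S.ricAc p (e i) (e j) * (inner ℝ (S.xi p x (e i)) (e j) : ℝ) =
      -∑ i, ∑ j, S.ricAc p (e i) (e j) * (inner ℝ (S.xi p x (e i)) (e j) : ℝ) := by
    conv_lhs => rw [Finset.sum_comm]
    simp only [← Finset.sum_neg_distrib]
    refine Finset.sum_congr rfl fun i _ => Finset.sum_congr rfl fun j _ => ?_
    rw [hsymm, hskew]
    ring
  linarith

/-- The scalar curvature identity for weakly-ac-Einstein structures. -/
theorem sub_one_mul_mvfderiv_scalAc (hS : S.IsTypeC1toC10) {n : ℕ}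
    (hE : S.IsWeaklyAcEinstein n) (e : OrthonormalBasis (Fin m) ℝ (TangentSpace 𝓘(ℝ, E) p))
    (x : TangentSpace 𝓘(ℝ, E) p) :
    (n - 1 : ℝ) * mvfderiv 𝓘(ℝ, E) S.scalAc p x
        + (mvfderiv 𝓘(ℝ, E) S.scalAc p (S.zeta p)
          + S.scalAc p * codiffForm S.eta p) * S.eta p x =
      2 * n * (∑ i, ∑ j, (inner ℝ (curvature p (e i) x (e j))
          (S.xi p (S.phi p (e i)) (S.phi p (e j))) : ℝ))
        - 2 * S.scalAc p * (inner ℝ (∑ i, S.xi p (e i) (e i)) x : ℝ) := by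
  -- For `n = 0` the factor `1 / (2 * n)` is `0` by convention, so `Ric^ac` and `s^ac` vanish and
  -- both sides are zero.
  rcases Nat.eq_zero_or_pos n with rfl | hn
  · have hs : S.scalAc = fun _ : M => (0 : ℝ) := by
      funext q
      have h0 : ∀ v w, S.ricAc q v w = 0 := by
        intro v w
        rw [hE q v w]
        simp
      simp [scalAc, h0]
    simp [hs, mvfderiv_const]
  have hn0 : (n : ℝ) ≠ 0 := Nat.cast_ne_zero.2 hn.ne'
  have h1 := S.two_mul_codiffBilin_ricAcT_add hS e x
  have h2 : S.ricAc p (S.zeta p) (S.phi p x) = 0 := by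
    simp [hE p, eta, S.inner_zeta_phi]
  have h3 : S.eta p (∑ i, S.xi p (e i) (e i)) = -codiffForm S.eta p := S.inner_zeta_sum_xi e
  -- The `d^*η` terms from the divergence and from `Ric^ac(x, ξ_{e_i} e_i)` have different weights
  -- and combine to the single `s^ac d^*η η(x)` of the claim once the factor `n` is cleared.
  rw [S.codiffBilin_ricAcT_of_einstein hS hE, S.sum_ricAc_mul_xi_of_einstein hE, h2,
    hE p x (∑ i, S.xi p (e i) (e i)), h3, real_inner_comm _ x] at h1
  field_simp at h1
  linear_combination h1 / 2

end AlmostContactMetric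

end AlmostContact

end

theorem lemma4p7 {n : ℕ} {M : Type*} [TopologicalSpace M] [T2Space M]
    [ChartedSpace (EuclideanSpace ℝ (Fin (2 * n + 1))) M]
    [IsManifold (𝓡 (2 * n + 1)) ∞ M]
    [RiemannianBundle (fun x : M => TangentSpace (𝓡 (2 * n + 1)) x)]
    [IsContMDiffRiemannianBundle (𝓡 (2 * n + 1)) ∞ (EuclideanSpace ℝ (Fin (2 * n + 1)))
      (fun x : M => TangentSpace (𝓡 (2 * n + 1)) x)]
    (S : AlmostContact.AlmostContactMetric (EuclideanSpace ℝ (Fin (2 * n + 1))) M)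
    (hS : S.IsTypeC1toC10) :
    (∀ (p : M) (e : OrthonormalBasis (Fin (2 * n + 1)) ℝ (TangentSpace (𝓡 (2 * n + 1)) p))
        (X : TangentSpace (𝓡 (2 * n + 1)) p),
      2 * AlmostContact.codiffBilin S.ricAcT p X + mvfderiv (𝓡 (2 * n + 1)) S.scalAc p X =
        2 * (∑ i, ∑ j, (inner ℝ (AlmostContact.curvature p (e i) X (e j))
            (S.xi p (S.phi p (e i)) (S.phi p (e j))) : ℝ))
          - 4 * S.ricAc p X (∑ i, S.xi p (e i) (e i))
          + 4 * (∑ i, ∑ j, S.ricAc p (e i) (e j) * (inner ℝ (S.xi p X (e i)) (e j) : ℝ))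
          - 2 * AlmostContact.codiffBilin S.fund p (S.zeta p)
            * S.ricAc p (S.zeta p) (S.phi p X)) ∧
    (S.IsWeaklyAcEinstein n →
      ∀ (p : M) (e : OrthonormalBasis (Fin (2 * n + 1)) ℝ (TangentSpace (𝓡 (2 * n + 1)) p))
        (X : TangentSpace (𝓡 (2 * n + 1)) p),
      (n - 1 : ℝ) * mvfderiv (𝓡 (2 * n + 1)) S.scalAc p X
          + (mvfderiv (𝓡 (2 * n + 1)) S.scalAc p (S.zeta p)
            + S.scalAc p * AlmostContact.codiffForm S.eta p) * S.eta p X =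
        2 * n * (∑ i, ∑ j, (inner ℝ (AlmostContact.curvature p (e i) X (e j))
            (S.xi p (S.phi p (e i)) (S.phi p (e j))) : ℝ))
          - 2 * S.scalAc p * (inner ℝ (∑ i, S.xi p (e i) (e i)) X : ℝ)) :=
  ⟨fun _ e X => S.two_mul_codiffBilin_ricAcT_add hS e X,
    fun hE _ e X => S.sub_one_mul_mvfderiv_scalAc hS hE e X⟩
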